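/- Let $e_1,e_2,e_3$ be the standard basis of $\mathbb R^3$ and let $\Upsilon=\{s e_i : i\in\{1,2,3\},\ 0\le s\le 1\}\subset\mathbb R^3$ be the Y-graph. A point $x\in\Upsilon$ is written $x=|x|\,e_{\iota(x)}$, where the index $\iota(x)$ is undefined for $x=0$; indices are added modulo $3$. Let $\Delta\subset\Upsilon\times\Upsilon$ be the diagonal and let $\mathcal C=(\Upsilon\times\Upsilon)\setminus\Delta$ be the configuration space of two distinct points on $\Upsilon$. Let $\mathcal D=\{(x,y)\in\mathcal C:\iota(x)\ne\iota(y)\}$ (an undefined index counts as different from a defined one) and $\partial\mathcal D=\{(x,y)\in\mathcal D : |x|=1 \text{ or } |y|=1\}$. **Theorem.** There exists a piecewise-smooth vector field $X$ on $\mathcal C$ (at each point tangent to $\mathcal C$, and, on each of finitely many convex cells with polytopal closure that together make up $\mathcal C$, the restriction of a $C^\infty$ map) with the properties 1–3 below. Explicitly, they hold for the field $X(x,y)=(\dot x,\dot y)$ given by * if $\iota(x)=\iota(y)$: $\ (-|y|e_{\iota(x)},\ |y|(1-|y|)e_{\iota(y)})$ for $0<|x|<|y|$, and $(|x|(1-|x|)e_{\iota(x)},\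 -|x|e_{\iota(y)})$ for $0<|y|<|x|$; * if $\iota(x)=\iota(y)+1$ or $x=0$: $\ (|y|e_{\iota(y)+1},\ |y|(1-|y|)e_{\iota(y)})$ for $0\le|x|<|y|$, and $(|x|(1-|x|)e_{\iota(x)},\ -|x|e_{\iota(y)})$ for $0<|y|\le|x|$; * if $\iota(y)=\iota(x)+1$ or $y=0$: $\ (-|y|e_{\iota(x)},\ |y|(1-|y|)e_{\iota(y)})$ for $0<|x|\le|y|$, and $(|x|(1-|x|)e_{\iota(x)},\ |x|e_{\iota(x)+1})$ for $0\le|y|<|x|$. 1. $X$ vanishes nowhere and generates a continuous semiflow $\varphi:[0,\infty)\times\mathcal C\to\mathcal C$: for every $p$, the curve $t\mapsto\varphi_t(p)$ has right derivative $X(\varphi_t(p))$ at every $t\ge0$, and every continuous curve $\gamma:[0,T)\to\mathcal C$ with right derivative $X(\gamma(t))$ at every $t$ satisfies $\gamma(t)=\varphi_t(\gamma(0))$. 2. The diagonal $\Delta$ is repelling: it has a neighbourhood $U$ such that for every neighbourhood $V$ of $\Delta$ there is a time $T$ with $\varphi_t(p)\notin U$ for all $p\in\mathcal C\setminus V$ and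 all $t\ge T$. 3. The set $\Gamma=\partial\mathcal D$ is an attracting limit cycle (a nonconstant periodic orbit that is the limit of an orbit starting off $\Gamma$, is Lyapunov stable, and is approached by all orbits starting near it) and is the only periodic orbit of $\varphi$. Every orbit approaches $\Gamma$: it is eventually in each neighbourhood of $\Gamma$, and its $\omega$-limit set is $\Gamma$. The cycle runs through all ordered pairs of distinct edge-states: for all $p\in\Gamma$ and $i\neq j$ there is $t\ge0$ such that, at $\varphi_t(p)=(x,y)$, $\iota(x)=i$ and $\iota(y)=j$. -/

import Mathlib

open Set Filter Topology
open scoped NNReal ContDiff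

noncomputable section

namespace YGraph

/-- Pairs of vectors of `ℝ³`. Only the topology and the linear structure matter; the norm used on
`ℝ³` is the maximum norm, and `‖s • e i‖ = s` for `0 ≤ s`, as for the Euclidean norm. -/
abbrev Pairs : Type := (Fin 3 → ℝ) × (Fin 3 → ℝ)

/-- The `i`-th unit vector of `ℝ³`; it is also the outward unit tangent vector of the edge `i`. -/
def e (i : Fin 3) : Fin 3 → ℝ := Pi.single i 1

/-- The Y-graph, as the positive unit axis frame in `ℝ³`; the central vertex is `0`. -/
def graph : Set (Fin 3 → ℝ) := {x | ∃ i : Fin 3, ∃ s ∈ Icc (0 : ℝ) 1, x = s • e i}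

/-- The diagonal of the product of the Y-graph with itself. -/
def diagonal : Set Pairs := {p | p.1 ∈ graph ∧ p.2 = p.1}

/-- The configuration space of two distinct labelled points on the Y-graph. -/
def Config : Set Pairs := {p | p.1 ∈ graph ∧ p.2 ∈ graph ∧ p.1 ≠ p.2}

/-- The index of a point of the Y-graph: `some i` on the `i`-th edge without the central vertex,
undefined (`none`) at the central vertex. -/
def index (x : Fin 3 → ℝ) : Option (Fin 3) :=
  if 0 < x 0 then some 0 else if 0 < x 1 then some 1 else if 0 < x 2 then some 2 else none

/-- The unfinned region (a punctured disc): the configurations whose two points do not have the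
same index, where an undefined index differs from a defined one. -/
def disc : Set Config := {p | index p.1.1 ≠ index p.1.2}

/-- The boundary of the disc: one of the two points is at an outer vertex. -/
def discBoundary : Set Config := {p | p ∈ disc ∧ (‖p.1.1‖ = 1 ∨ ‖p.1.2‖ = 1)}

/-- The circulating vector field. Addition of indices is modulo three. -/
def circulatingField (p : Config) : Pairs :=
  let x := p.1.1
  let y := p.1.2
  let a := ‖x‖
  let b := ‖y‖
  match index x, index y with
  | some i, some j =>
    if i = j then
      if a < b then (-b • e i, (b * (1 - b)) • e j)
      else ((a * (1 - a)) • e i, -a • e j)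
    else if i = j + 1 then
      if a < b then (b • e (j + 1), (b * (1 - b)) • e j)
      else ((a * (1 - a)) • e i, -a • e j)
    else -- here `j = i + 1`
      if a ≤ b then (-b • e i, (b * (1 - b)) • e j)
      else ((a * (1 - a)) • e i, a • e (i + 1))
  | none, some j => (b • e (j + 1), (b * (1 - b)) • e j)
  | some i, none => ((a * (1 - a)) • e i, a • e (i + 1))
  | none, none => 0 -- does not occur in the configuration space

/-- `X` is a piecewise-smooth vector field on the configuration space: its value at each point is
tangent to the space (lies in the contingent cone), and the space is the union of finitely many
cells, i.e. convex sets whose closures are polytopes, on each of which `X` is the restriction of a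
smooth map. -/
def IsPiecewiseSmoothVectorField (X : Config → Pairs) : Prop :=
  (∀ p : Config, X p ∈ posTangentConeAt Config (p : Pairs)) ∧
  ∃ (n : ℕ) (S : Fin n → Set Pairs) (F : Fin n → Pairs → Pairs),
    (⋃ k, S k) = Config ∧
    ∀ k, Convex ℝ (S k) ∧ (∃ V : Set Pairs, V.Finite ∧ closure (S k) = convexHull ℝ V) ∧
      ContDiff ℝ ∞ (F k) ∧ ∀ p : Config, (p : Pairs) ∈ S k → X p = F k p

/-- `γ` is a forward orbit of `X` on `[0, T)`: a continuous curve in the configuration space whose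
right derivative at every time is the value of `X`. -/
def IsForwardSolution (X : Config → Pairs) (T : ℝ) (γ : ℝ → Config) : Prop :=
  ContinuousOn γ (Ico 0 T) ∧
  ∀ t ∈ Ico 0 T, HasDerivWithinAt (fun s => (γ s : Pairs)) (X (γ t)) (Ici t) t

/-- `X` generates the (continuous) semiflow `φ`: the orbits of `φ` are forward orbits of `X`, and
forward orbits of `X` are unique. -/
def Generates (X : Config → Pairs) (φ : Flow ℝ≥0 Config) : Prop :=
  (∀ (p : Config) (T : ℝ), IsForwardSolution X T (fun t => φ t.toNNReal p)) ∧
  ∀ (T : ℝ) (γ : ℝ → Config), IsForwardSolution X T γ →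
    ∀ t ∈ Ico 0 T, γ t = φ t.toNNReal (γ 0)

/-- The set `A` of pairs is repelling for the semiflow `φ`: it has a neighbourhood `U` such that
all orbits which start off any prescribed neighbourhood of `A`, however small, are outside of `U`
from a common time on. -/
def IsRepelling (φ : Flow ℝ≥0 Config) (A : Set Pairs) : Prop :=
  ∃ U ∈ 𝓝ˢ A, ∀ V ∈ 𝓝ˢ A, ∃ T : ℝ≥0, ∀ p : Config, (p : Pairs) ∉ V →
    ∀ t ≥ T, (φ t p : Pairs) ∉ U

section Semiflow

variable {α : Type*} [TopologicalSpace α]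

/-- `Γ` is a (nonconstant) periodic orbit of `φ`. -/
def IsPeriodicOrbit (φ : Flow ℝ≥0 α) (Γ : Set α) : Prop :=
  ∃ p : α, (∃ T > 0, φ T p = p) ∧ (∃ t, φ t p ≠ p) ∧ Γ = range (fun t => φ t p)

/-- The orbit of `p` approaches `Γ`: it is eventually in each neighbourhood of `Γ` and accumulates
exactly at the points of `Γ`. -/
def Approaches (φ : Flow ℝ≥0 α) (p : α) (Γ : Set α) : Prop :=
  Tendsto (fun t => φ t p) atTop (𝓝ˢ Γ) ∧ omegaLimit atTop φ {p} = Γ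

/-- `Γ` is an attracting limit cycle: a periodic orbit which is the limit of some orbit that
starts off it, is stable, and is approached by all orbits that start near it. -/
def IsAttractingLimitCycle (φ : Flow ℝ≥0 α) (Γ : Set α) : Prop :=
  IsPeriodicOrbit φ Γ ∧
  (∃ q, q ∉ Γ ∧ Approaches φ q Γ) ∧
  (∀ V ∈ 𝓝ˢ Γ, ∃ W ∈ 𝓝ˢ Γ, ∀ p ∈ W, ∀ t, φ t p ∈ V) ∧
  (∃ W ∈ 𝓝ˢ Γ, ∀ p ∈ W, Approaches φ p Γ)

end Semiflow

end YGraph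

end

open Set Filter Topology
open scoped NNReal ContDiff

noncomputable section

namespace YGraph

/-! ### Charts of the configuration space -/

/-! Call the point farther from the centre the leader. Each configuration has a chart `conf r i j M
v`: the leader is at distance `M` on edge `i`, the other point has coordinate `v` on the line that
joins edge `j` to edge `i + 1`. In the half-open chart `v < M` the field reads M' = M(1 - M), v' = M
(`circulatingField_conf`): the trailing point passes through the centre onto edge `i + 1` and
catches up in distance. At `v = M` the roles are exchanged, and the same configuration is the start
`v = -M` of another chart (`conf_tie`). Charts with different `j` merge at `v = 0`, so orbits merge
and only a semiflow can be expected.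

The chart equations are solved by `growth` and `travel`. Their `gap` has derivative `growth ^ 2 >
0`, so the exchange time `hit` is unique, and it is continuous in the data. Successive exchanges are
at least log 3 > 1 apart, so a unit time step meets at most one; unit steps are continuous, and
composing them gives the semiflow. A forward orbit stays for a while in the half-open chart of its
position and solves the chart equations there, which gives uniqueness (`IsForwardSolution.eqOn`).

For the asymptotics, `M` is the norm of the pair, so the norm grows logistically through all
exchanges and tends to 1 (`norm_semiflow`). In the first unit of time `v` grows by at least `M`, so
from time 1 on the orbit is in the disc. Hence each orbit is eventually in every compact set `core
c` with 0 < c < 1, and these shrink to Γ = `core 1`. On Γ the motion is v' = 1 along six arcs joined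
in a cycle, so Γ is a single periodic orbit (`exists_semiflow_eq`). An ω-limit set is nonempty,
invariant and contained in Γ, hence equal to Γ; a periodic point lies in its own ω-limit set, hence
on Γ. The cores avoid the diagonal, and the time to reach one depends only on a lower bound for the
norm, so the diagonal repels. -/

theorem smul_e_apply (s : ℝ) (i k : Fin 3) : (s • e i) k = if k = i then s else 0 := by
  by_cases h : k = i
  · subst h; simp [e]
  · simp [e, h]

theorem e_ne_zero (i : Fin 3) : e i ≠ 0 := by simp [e]

theorem norm_e (i : Fin 3) : ‖e i‖ = 1 := by
  rw [e, Pi.norm_single, norm_one]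

theorem norm_smul_e (s : ℝ) (i : Fin 3) : ‖s • e i‖ = |s| := by
  rw [norm_smul, norm_e, mul_one, Real.norm_eq_abs]

theorem smul_e_mem_graph {s : ℝ} (i : Fin 3) (h0 : 0 ≤ s) (h1 : s ≤ 1) : s • e i ∈ graph :=
  ⟨i, s, ⟨h0, h1⟩, rfl⟩

theorem index_zero : index 0 = none := by simp [index]

theorem index_smul_e {s : ℝ} (hs : 0 < s) (i : Fin 3) : index (s • e i) = some i := by
  simp only [index, smul_e_apply]
  fin_cases i <;> simp [hs]

theorem smul_e_inj {s t : ℝ} {i j : Fin 3} (hs : s ≠ 0) (h : s • e i = t • e j) :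
    i = j ∧ s = t := by
  have h1 := congrFun h i
  rw [smul_e_apply, smul_e_apply, if_pos rfl] at h1
  by_cases hij : i = j
  · rw [if_pos hij] at h1; exact ⟨hij, h1⟩
  · rw [if_neg hij] at h1; exact absurd h1 hs

theorem eq_smul_of_mem_graph {x : Fin 3 → ℝ} (hx : x ∈ graph) {i : Fin 3} (hi : x i ≠ 0) :
    x = x i • e i := by
  obtain ⟨k, s, -, rfl⟩ := hx
  rw [smul_e_apply] at hi
  by_cases h : i = k
  · subst h; rw [smul_e_apply, if_pos rfl]
  · simp [h] at hi

theorem mem_Icc_of_mem_graph {x : Fin 3 → ℝ} (hx : x ∈ graph) (i : Fin 3) :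
    x i ∈ Icc (0 : ℝ) 1 := by
  obtain ⟨k, s, hs, rfl⟩ := hx
  rw [smul_e_apply]
  split_ifs
  · exact hs
  · simp

/-- A pair whose leading component is `a` and whose other component is `b`; the leading component
is the second one if `r` is true. -/
def pack (r : Bool) (a b : Fin 3 → ℝ) : Pairs := bif r then (b, a) else (a, b)

/-- The line formed by the edges `j` (negative parameters) and `i + 1` (positive parameters). -/
def leg (i j : Fin 3) (v : ℝ) : Fin 3 → ℝ := max (-v) 0 • e j + max v 0 • e (i + 1)

/-- The configuration whose leading point is at distance `M` from the centre on the edge `i` and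
whose other point has the coordinate `v` on the line formed by the edges `j` and `i + 1`. -/
def conf (r : Bool) (i j : Fin 3) (M v : ℝ) : Pairs := pack r (M • e i) (leg i j v)

/-- The admissible parameters of `conf`. -/
structure Adm (i j : Fin 3) (M v : ℝ) : Prop where
  pos : 0 < M
  le_one : M ≤ 1
  neg_le : -M ≤ v
  le : v ≤ M
  ne : j ≠ i + 1
  lt : j = i → -M < v

theorem leg_of_nonpos (i j : Fin 3) {v : ℝ} (hv : v ≤ 0) : leg i j v = (-v) • e j := by
  rw [leg, max_eq_left (by linarith), max_eq_right hv, zero_smul, add_zero]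

theorem leg_of_nonneg (i j : Fin 3) {v : ℝ} (hv : 0 ≤ v) : leg i j v = v • e (i + 1) := by
  rw [leg, max_eq_right (by linarith), max_eq_left hv, zero_smul, zero_add]

theorem norm_leg (i j : Fin 3) (v : ℝ) : ‖leg i j v‖ = |v| := by
  rcases le_total v 0 with h | h
  · rw [leg_of_nonpos i j h, norm_smul_e, abs_neg]
  · rw [leg_of_nonneg i j h, norm_smul_e]

theorem leg_mem_graph (i j : Fin 3) {v : ℝ} (hv : |v| ≤ 1) : leg i j v ∈ graph := by
  rcases le_total v 0 with h | h
  · rw [leg_of_nonpos i j h]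
    exact smul_e_mem_graph _ (by linarith) (by linarith [neg_abs_le v])
  · rw [leg_of_nonneg i j h]
    exact smul_e_mem_graph _ h (by linarith [le_abs_self v])

theorem leg_coord {i j : Fin 3} (hj : j ≠ i + 1) (v : ℝ) : leg i j v (i + 1) - leg i j v j = v := by
  rcases le_total v 0 with h | h
  · rw [leg_of_nonpos i j h, smul_e_apply, smul_e_apply]; simp [hj.symm]
  · rw [leg_of_nonneg i j h, smul_e_apply, smul_e_apply]; simp [hj]

theorem norm_pack (r : Bool) (a b : Fin 3 → ℝ) : ‖pack r a b‖ = max ‖a‖ ‖b‖ := by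
  cases r <;> simp [pack, Prod.norm_def, max_comm]

theorem pack_mem_Config {r : Bool} {a b : Fin 3 → ℝ} :
    pack r a b ∈ Config ↔ a ∈ graph ∧ b ∈ graph ∧ a ≠ b := by
  cases r
  · simp [pack, Config]
  · simp only [pack, Config, cond_true, mem_ofPred_eq]
    constructor
    · rintro ⟨h1, h2, h3⟩; exact ⟨h2, h1, h3.symm⟩
    · rintro ⟨h1, h2, h3⟩; exact ⟨h2, h1, h3.symm⟩

theorem continuous_pack (r : Bool) :
    Continuous (fun q : (Fin 3 → ℝ) × (Fin 3 → ℝ) => pack r q.1 q.2) := by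
  cases r <;> simp only [pack, cond_true, cond_false] <;> fun_prop

theorem continuous_leg (i j : Fin 3) : Continuous (leg i j) := by
  unfold leg; fun_prop

theorem continuous_conf (r : Bool) (i j : Fin 3) :
    Continuous (fun q : ℝ × ℝ => conf r i j q.1 q.2) := by
  have h := continuous_leg i j
  exact (continuous_pack r).comp (f := fun q : ℝ × ℝ => (q.1 • e i, leg i j q.2))
    (by fun_prop)

/-- At equal distances either point may be called the leader. Renaming turns the end of one chart
into the start of the next, whose leading edge is `i + 1`. -/
theorem conf_tie (r : Bool) (i j : Fin 3) {M : ℝ} (hM : 0 ≤ M) :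
    conf r i j M M = conf (!r) (i + 1) i M (-M) := by
  rw [conf, conf, leg_of_nonneg i j hM, leg_of_nonpos (i + 1) i (by linarith), neg_neg]
  cases r <;> simp [pack]

theorem Adm.abs_le {i j : Fin 3} {M v : ℝ} (h : Adm i j M v) : |v| ≤ M :=
  _root_.abs_le.2 ⟨h.neg_le, h.le⟩

theorem norm_conf (r : Bool) {i j : Fin 3} {M v : ℝ} (h : Adm i j M v) : ‖conf r i j M v‖ = M := by
  rw [conf, norm_pack, norm_smul_e, norm_leg, abs_of_pos h.pos, max_eq_left h.abs_le]

theorem conf_mem_Config (r : Bool) {i j : Fin 3} {M v : ℝ} (h : Adm i j M v) :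
    conf r i j M v ∈ Config := by
  rw [conf, pack_mem_Config]
  refine ⟨smul_e_mem_graph i h.pos.le h.le_one, leg_mem_graph i j (h.abs_le.trans h.le_one), ?_⟩
  intro heq
  rcases le_total v 0 with hv | hv
  · rw [leg_of_nonpos i j hv] at heq
    obtain ⟨h1, h2⟩ := smul_e_inj h.pos.ne' heq
    have := h.lt h1.symm
    linarith
  · rw [leg_of_nonneg i j hv] at heq
    have := (smul_e_inj h.pos.ne' heq).1
    simp at this

theorem fin_ne_add_one (i : Fin 3) : i ≠ i + 1 := by
  revert i; decide

theorem fin_ne_add_two (i : Fin 3) : i ≠ i + 1 + 1 := by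
  revert i; decide

theorem fin_three_cases {i j : Fin 3} (h1 : j ≠ i) (h2 : j ≠ i + 1) : i = j + 1 := by
  revert i j; decide

theorem norm_pos_of_mem_Config {p : Pairs} (hp : p ∈ Config) : 0 < ‖p‖ := by
  rw [norm_pos_iff]
  rintro rfl
  exact hp.2.2 rfl

/-- A trailing point on edge `i + 1` gets `v = b`, and then `j` is irrelevant and set to `i`; on any
other edge `k` it gets `j = k` and `v = -b`. -/
theorem exists_conf_of_le (r : Bool) {i k : Fin 3} {a b : ℝ} (ha : 0 < a) (ha1 : a ≤ 1)
    (hb : 0 ≤ b) (hba : b ≤ a) (hk : k = i → b < a) (hk' : k = i + 1 → b < a) :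
    ∃ j v, Adm i j a v ∧ v < a ∧ pack r (a • e i) (b • e k) = conf r i j a v := by
  by_cases h : k = i + 1
  · refine ⟨i, b, ⟨ha, ha1, by linarith, hba, by simp, fun _ => by linarith⟩, hk' h, ?_⟩
    rw [conf, leg_of_nonneg _ _ hb, h]
  · refine ⟨k, -b, ⟨ha, ha1, by linarith, by linarith, h, fun h' => by linarith [hk h']⟩,
      by linarith, ?_⟩
    rw [conf, leg_of_nonpos _ _ (by linarith), neg_neg]

/-- Every configuration is in the image of a half-open chart. -/
theorem exists_conf {p : Pairs} (hp : p ∈ Config) :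
    ∃ r i j M v, Adm i j M v ∧ v < M ∧ p = conf r i j M v := by
  obtain ⟨x, y⟩ := p
  obtain ⟨⟨i, a, ⟨ha0, ha1⟩, hx⟩, ⟨k, b, ⟨hb0, hb1⟩, hy⟩, hne⟩ := hp
  simp only at hx hy hne
  subst hx hy
  have hxy : (a • e i, b • e k) = pack false (a • e i) (b • e k) := rfl
  have hyx : (a • e i, b • e k) = pack true (b • e k) (a • e i) := rfl
  rcases lt_trichotomy a b with h | h | h
  · obtain ⟨j, v, h1, h2, h3⟩ := exists_conf_of_le true (i := k) (k := i) (by linarith) hb1 ha0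
      h.le (fun _ => h) (fun _ => h)
    exact ⟨true, k, j, b, v, h1, h2, hyx.trans h3⟩
  · subst h
    have hki : k ≠ i := fun h => hne (by rw [h])
    have ha : 0 < a := by
      rcases ha0.eq_or_lt with h | h
      · exact absurd (by rw [← h]; simp) hne
      · exact h
    -- In a tie only one naming satisfies `v < M`: the leader is the point whose edge follows that
    -- of the other, which then has `v = -M`.
    by_cases hk : k = i + 1
    · obtain ⟨j, v, h1, h2, h3⟩ := exists_conf_of_le true (i := k) (k := i) ha hb1 ha0
        le_rfl (fun h => absurd h.symm hki)
        (fun h => absurd (h.trans (by rw [hk])) (fin_ne_add_two i))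
      exact ⟨true, k, j, a, v, h1, h2, hyx.trans h3⟩
    · obtain ⟨j, v, h1, h2, h3⟩ := exists_conf_of_le false (i := i) (k := k) ha ha1 hb0
        le_rfl (fun h => absurd h hki) (fun h => absurd h hk)
      exact ⟨false, i, j, a, v, h1, h2, hxy.trans h3⟩
  · obtain ⟨j, v, h1, h2, h3⟩ := exists_conf_of_le false (i := i) (k := k) (by linarith) ha1 hb0
      h.le (fun _ => h) (fun _ => h)
    exact ⟨false, i, j, a, v, h1, h2, hxy.trans h3⟩

theorem norm_le_one_of_mem_Config {p : Pairs} (hp : p ∈ Config) : ‖p‖ ≤ 1 := by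
  obtain ⟨r, i, j, M, v, h, -, rfl⟩ := exists_conf hp
  rw [norm_conf r h]
  exact h.le_one

/-! ### The field in the charts -/

theorem circulatingField_smul {a b : ℝ} (ha : 0 < a) (hb : 0 < b) {i j : Fin 3} {p : Config}
    (hp : (p : Pairs) = (a • e i, b • e j)) :
    circulatingField p =
      if i = j then
        if a < b then (-b • e i, (b * (1 - b)) • e j)
        else ((a * (1 - a)) • e i, -a • e j)
      else if i = j + 1 then
        if a < b then (b • e (j + 1), (b * (1 - b)) • e j)
        else ((a * (1 - a)) • e i, -a • e j)
      else
        if a ≤ b then (-b • e i, (b * (1 - b)) • e j)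
        else ((a * (1 - a)) • e i, a • e (i + 1)) := by
  simp only [circulatingField, hp, index_smul_e ha, index_smul_e hb, norm_smul_e, abs_of_pos ha,
    abs_of_pos hb]

/-- The circulating field in a half-open chart. -/
theorem circulatingField_conf {r : Bool} {i j : Fin 3} {M v : ℝ} (h : Adm i j M v) (hv : v < M)
    {p : Config} (hp : (p : Pairs) = conf r i j M v) :
    circulatingField p =
      pack r ((M * (1 - M)) • e i) (if v < 0 then (-M) • e j else M • e (i + 1)) := by
  have hM := h.pos
  have hMv := h.neg_le
  rcases lt_trichotomy v 0 with h0 | h0 | h0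
  · have hv' : 0 < -v := by linarith
    rw [conf, leg_of_nonpos i j h0.le] at hp
    rw [if_pos h0]
    by_cases hji : j = i
    · have := h.lt hji
      cases r
      · rw [circulatingField_smul hM hv' hp, if_pos hji.symm, if_neg (by linarith)]; rfl
      · rw [circulatingField_smul hv' hM hp, if_pos hji, if_pos (by linarith)]; rfl
    · cases r
      · rw [circulatingField_smul hM hv' hp, if_neg (Ne.symm hji),
          if_pos (fin_three_cases hji h.ne), if_neg (by linarith)]; rfl
      · rw [circulatingField_smul hv' hM hp, if_neg hji, if_neg h.ne, if_pos (by linarith)]; rfl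
  · subst h0
    rw [conf, leg_of_nonneg i j le_rfl, zero_smul] at hp
    cases r <;> simp [circulatingField, pack, hp, index_smul_e hM, index_zero, norm_smul_e,
        abs_of_pos hM, -Pi.smul_apply]
  · rw [conf, leg_of_nonneg i j h0.le] at hp
    rw [if_neg h0.not_gt]
    cases r
    · rw [circulatingField_smul hM h0 hp, if_neg (fin_ne_add_one i), if_neg (fin_ne_add_two i),
        if_neg (by linarith)]; rfl
    · rw [circulatingField_smul h0 hM hp, if_neg (fin_ne_add_one i).symm, if_pos rfl,
        if_pos hv]; rfl

theorem circulatingField_ne_zero (p : Config) : circulatingField p ≠ 0 := by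
  obtain ⟨r, i, j, M, v, h, hv, hp⟩ := exists_conf p.2
  rw [circulatingField_conf h hv hp]
  intro h0
  have := h.pos
  cases r <;> simp [pack, Prod.ext_iff] at h0 <;> split_ifs at h0 <;>
    simp [e_ne_zero, this.ne'] at h0

/-! ### The motion in a chart -/

/-- The denominator of the solution of the logistic equation. -/
def denom (M t : ℝ) : ℝ := 1 + M * (Real.exp t - 1)

/-- The solution of the logistic equation `M' = M (1 - M)`. -/
def growth (M t : ℝ) : ℝ := M * Real.exp t / denom M t

/-- The integral of `growth M` from `0` to `t`. -/
def travel (M t : ℝ) : ℝ := Real.log (denom M t)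

theorem one_le_denom {M t : ℝ} (hM : 0 ≤ M) (ht : 0 ≤ t) : 1 ≤ denom M t := by
  have : 1 ≤ Real.exp t := Real.one_le_exp ht
  unfold denom
  nlinarith

theorem denom_pos {M t : ℝ} (hM : 0 ≤ M) (ht : 0 ≤ t) : 0 < denom M t :=
  zero_lt_one.trans_le (one_le_denom hM ht)

theorem denom_zero (M : ℝ) : denom M 0 = 1 := by simp [denom]

theorem growth_zero (M : ℝ) : growth M 0 = M := by simp [growth, denom_zero]

theorem travel_zero (M : ℝ) : travel M 0 = 0 := by simp [travel, denom_zero]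

theorem growth_one (t : ℝ) : growth 1 t = 1 := by
  have : denom 1 t = Real.exp t := by unfold denom; ring
  rw [growth, this, one_mul, div_self (Real.exp_pos t).ne']

theorem travel_one (t : ℝ) : travel 1 t = t := by
  have : denom 1 t = Real.exp t := by unfold denom; ring
  rw [travel, this, Real.log_exp]

theorem growth_pos {M t : ℝ} (hM : 0 < M) (ht : 0 ≤ t) : 0 < growth M t :=
  div_pos (mul_pos hM (Real.exp_pos t)) (denom_pos hM.le ht)

theorem growth_le_one {M t : ℝ} (hM : 0 < M) (hM1 : M ≤ 1) (ht : 0 ≤ t) : growth M t ≤ 1 := by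
  rw [growth, div_le_one (denom_pos hM.le ht)]
  unfold denom
  linarith

/-- The semigroup law of the logistic equation rests on the cocycle identity `h4` for the
denominators. -/
theorem growth_add {M s t : ℝ} (hM : 0 < M) (hs : 0 ≤ s) (ht : 0 ≤ t) :
    growth (growth M s) t = growth M (s + t) := by
  have h1 := denom_pos hM.le hs
  have h2 := denom_pos hM.le (add_nonneg hs ht)
  have h3 := denom_pos (growth_pos hM hs).le ht
  have h4 : denom (growth M s) t = denom M (s + t) / denom M s := by
    rw [eq_div_iff h1.ne', denom, growth, add_mul, mul_right_comm, div_mul_cancel₀ _ h1.ne', denom,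
      denom, Real.exp_add]
    ring
  rw [growth, h4, growth, growth, Real.exp_add]
  field_simp

theorem hasDerivAt_denom (M t : ℝ) : HasDerivAt (denom M) (M * Real.exp t) t :=
  (((Real.hasDerivAt_exp t).sub_const 1).const_mul M).const_add 1

theorem hasDerivAt_travel {M t : ℝ} (hM : 0 < M) (ht : 0 ≤ t) :
    HasDerivAt (travel M) (growth M t) t :=
  (hasDerivAt_denom M t).log (denom_pos hM.le ht).ne'

theorem hasDerivAt_growth {M t : ℝ} (hM : 0 < M) (ht : 0 ≤ t) :
    HasDerivAt (growth M) (growth M t * (1 - growth M t)) t := by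
  have h := denom_pos hM.le ht
  refine (((Real.hasDerivAt_exp t).const_mul M).div (hasDerivAt_denom M t) h.ne').congr_deriv ?_
  unfold growth
  field_simp

theorem travel_mono {M s t : ℝ} (hM : 0 < M) (hs : 0 ≤ s) (hst : s ≤ t) :
    travel M s ≤ travel M t := by
  apply Real.log_le_log (denom_pos hM.le hs)
  have := Real.exp_le_exp.2 hst
  unfold denom
  nlinarith

theorem travel_nonneg {M t : ℝ} (hM : 0 < M) (ht : 0 ≤ t) : 0 ≤ travel M t :=
  Real.log_nonneg (one_le_denom hM.le ht)

theorem growth_mono {M s t : ℝ} (hM : 0 < M) (hM1 : M ≤ 1) (hs : 0 ≤ s) (hst : s ≤ t) :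
    growth M s ≤ growth M t := by
  rw [growth, growth, div_le_div_iff₀ (denom_pos hM.le hs) (denom_pos hM.le (hs.trans hst))]
  have := Real.exp_le_exp.2 hst
  unfold denom
  nlinarith [mul_nonneg hM.le (sub_nonneg.2 hM1), mul_nonneg (mul_nonneg hM.le (sub_nonneg.2 hM1))
    (sub_nonneg.2 this)]

theorem le_growth {M t : ℝ} (hM : 0 < M) (hM1 : M ≤ 1) (ht : 0 ≤ t) : M ≤ growth M t := by
  simpa [growth_zero] using growth_mono hM hM1 le_rfl ht

/-- Makes the time needed to reach a given norm uniform over starting norms bounded below. -/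
theorem growth_mono_left {M N t : ℝ} (hM : 0 < M) (hMN : M ≤ N) (ht : 0 ≤ t) :
    growth M t ≤ growth N t := by
  rw [growth, growth, div_le_div_iff₀ (denom_pos hM.le ht) (denom_pos (hM.le.trans hMN) ht)]
  unfold denom
  nlinarith [Real.exp_pos t]

/-- From log x ≤ x - 1. This bounds from below the time between two exchanges. -/
theorem travel_sub_le {M s t : ℝ} (hM : 0 < M) (hs : 0 ≤ s) (ht : 0 ≤ t) :
    travel M t - travel M s ≤ growth M s * (Real.exp (t - s) - 1) := by
  have h1 := denom_pos hM.le hs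
  have h2 := denom_pos hM.le ht
  rw [travel, travel, ← Real.log_div h2.ne' h1.ne']
  refine (Real.log_le_sub_one_of_pos (div_pos h2 h1)).trans (le_of_eq ?_)
  have h3 : Real.exp t = Real.exp s * Real.exp (t - s) := by rw [← Real.exp_add]; congr 1; ring
  rw [growth, div_sub_one h1.ne', denom, denom, h3]
  ring

/-- In one unit of time a distance of at least `M` is travelled. -/
theorem le_travel_one {M : ℝ} (hM : 0 < M) (hM1 : M ≤ 1) : M ≤ travel M 1 := by
  rw [travel, Real.le_log_iff_exp_le (denom_pos hM.le zero_le_one)]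
  -- Convexity of exp between 0 and 1 gives exp M ≤ 1 + M (e - 1), which is `denom M 1`.
  have h := convexOn_exp.2 (mem_univ (0 : ℝ)) (mem_univ (1 : ℝ)) (sub_nonneg.2 hM1) hM.le
    (by ring)
  simp only [smul_eq_mul, mul_zero, mul_one, zero_add, Real.exp_zero] at h
  unfold denom
  linarith

theorem tendsto_growth {M : ℝ} (hM : 0 < M) : Tendsto (growth M) atTop (𝓝 1) := by
  -- Numerator and denominator of `growth` are divided by exp t.
  have h1 : Tendsto (fun t => M / (M + (1 - M) * Real.exp (-t))) atTop (𝓝 1) := by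
    have h : Tendsto (fun t : ℝ => M + (1 - M) * Real.exp (-t)) atTop (𝓝 (M + (1 - M) * 0)) :=
      ((Real.tendsto_exp_neg_atTop_nhds_zero).const_mul _).const_add _
    have h' := (tendsto_const_nhds (x := M)).div h (by simpa using hM.ne')
    rw [mul_zero, add_zero, div_self hM.ne'] at h'
    exact h'
  refine h1.congr fun t => ?_
  have h2 : M + (1 - M) * Real.exp (-t) = denom M t * Real.exp (-t) := by
    unfold denom
    have : Real.exp t * Real.exp (-t) = 1 := by rw [← Real.exp_add]; simp
    linear_combination (-M) * this
  rw [h2, growth, Real.exp_neg]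
  have := Real.exp_pos t
  field_simp

/-! ### The time of exchange -/

/-- The coordinate of the trailing point minus that of the leading point. -/
def gap (M v t : ℝ) : ℝ := v + travel M t - growth M t

/-- The derivative is growth - growth (1 - growth) = growth². -/
theorem strictMonoOn_gap {M : ℝ} (hM : 0 < M) (v : ℝ) : StrictMonoOn (gap M v) (Ici 0) := by
  have hd : ∀ t : ℝ, 0 ≤ t → HasDerivAt (gap M v) (growth M t ^ 2) t := fun t ht => by
    refine (((hasDerivAt_travel hM ht).const_add v).sub (hasDerivAt_growth hM ht)).congr_deriv ?_
    ring
  refine strictMonoOn_of_deriv_pos (convex_Ici 0)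
    (fun t ht => (hd t ht).continuousAt.continuousWithinAt) fun t ht => ?_
  rw [interior_Ici] at ht
  rw [(hd t (le_of_lt ht)).deriv]
  exact pow_pos (growth_pos hM (le_of_lt ht)) 2

theorem exists_gap_eq_zero {M v : ℝ} (hM : 0 < M) (hM1 : M ≤ 1) (hv : v ≤ M) :
    ∃ t, 0 ≤ t ∧ gap M v t = 0 := by
  -- Chosen so that `travel M s = 1 - v`: the trailing coordinate is then 1, which the leader cannot
  -- exceed.
  set s := Real.log (1 + (Real.exp (1 - v) - 1) / M) with hs
  have h1 : 1 ≤ Real.exp (1 - v) := Real.one_le_exp (by linarith)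
  have h2 : 0 ≤ (Real.exp (1 - v) - 1) / M := div_nonneg (by linarith) hM.le
  have hs0 : 0 ≤ s := Real.log_nonneg (by linarith)
  have hts : travel M s = 1 - v := by
    rw [travel, denom, hs, Real.exp_log (by linarith)]
    have : 1 + M * (1 + (Real.exp (1 - v) - 1) / M - 1) = Real.exp (1 - v) := by
      field_simp; ring
    rw [this, Real.log_exp]
  have hc : ContinuousOn (gap M v) (Icc 0 s) := fun t ht =>
    (((hasDerivAt_travel hM ht.1).const_add v).sub
      (hasDerivAt_growth hM ht.1)).continuousAt.continuousWithinAt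
  have h0 : gap M v 0 ≤ 0 := by rw [gap, travel_zero, growth_zero]; linarith
  have h3 : 0 ≤ gap M v s := by
    rw [gap, hts]; linarith [growth_le_one hM hM1 hs0]
  obtain ⟨t, ht, hgt⟩ := intermediate_value_Icc hs0 hc ⟨h0, h3⟩
  exact ⟨t, ht.1, hgt⟩

open Classical in
/-- The time at which the trailing point catches up with the leading point. -/
def hit (M v : ℝ) : ℝ := if h : ∃ t, 0 ≤ t ∧ gap M v t = 0 then h.choose else 0

/-- The parameters for which the trailing point has not passed the leading point. -/
def region : Set (ℝ × ℝ) := {q | 0 < q.1 ∧ q.1 ≤ 1 ∧ q.2 ≤ q.1}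

/-- The default value 0 of `hit` makes this true for all parameters. -/
theorem hit_nonneg (M v : ℝ) : 0 ≤ hit M v := by
  unfold hit
  split_ifs with h
  · exact h.choose_spec.1
  · exact le_rfl

theorem gap_hit {M v : ℝ} (hM : 0 < M) (hM1 : M ≤ 1) (hv : v ≤ M) : gap M v (hit M v) = 0 := by
  have h := exists_gap_eq_zero hM hM1 hv
  rw [hit, dif_pos h]
  exact h.choose_spec.2

/-- Turns comparisons with the implicitly defined `hit` into the sign of an explicit function. -/
theorem gap_neg_iff {M v t : ℝ} (hM : 0 < M) (hM1 : M ≤ 1) (hv : v ≤ M) (ht : 0 ≤ t) :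
    gap M v t < 0 ↔ t < hit M v := by
  rw [← gap_hit hM hM1 hv]
  exact (strictMonoOn_gap hM v).lt_iff_lt ht (hit_nonneg M v)

theorem gap_pos_iff {M v t : ℝ} (hM : 0 < M) (hM1 : M ≤ 1) (hv : v ≤ M) (ht : 0 ≤ t) :
    0 < gap M v t ↔ hit M v < t := by
  rw [← gap_hit hM hM1 hv]
  exact (strictMonoOn_gap hM v).lt_iff_lt (hit_nonneg M v) ht

theorem continuousAt_denom (q : ℝ × ℝ) : ContinuousAt (fun q : ℝ × ℝ => denom q.1 q.2) q := by
  unfold denom; fun_prop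

theorem continuousAt_growth {q : ℝ × ℝ} (hM : 0 ≤ q.1) (ht : 0 ≤ q.2) :
    ContinuousAt (fun q : ℝ × ℝ => growth q.1 q.2) q :=
  ContinuousAt.div (by fun_prop) (continuousAt_denom q) (denom_pos hM ht).ne'

theorem continuousAt_travel {q : ℝ × ℝ} (hM : 0 ≤ q.1) (ht : 0 ≤ q.2) :
    ContinuousAt (fun q : ℝ × ℝ => travel q.1 q.2) q :=
  (continuousAt_denom q).log (denom_pos hM ht).ne'

theorem continuousAt_gap {t : ℝ} (ht : 0 ≤ t) {q : ℝ × ℝ} (hq : 0 ≤ q.1) :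
    ContinuousAt (fun q : ℝ × ℝ => gap q.1 q.2 t) q := by
  have h1 : ContinuousAt (fun q : ℝ × ℝ => travel q.1 t) q :=
    ContinuousAt.comp (f := fun q : ℝ × ℝ => (q.1, t)) (continuousAt_travel hq ht) (by fun_prop)
  have h2 : ContinuousAt (fun q : ℝ × ℝ => growth q.1 t) q :=
    ContinuousAt.comp (f := fun q : ℝ × ℝ => (q.1, t)) (continuousAt_growth hq ht) (by fun_prop)
  exact (continuousAt_snd.add h1).sub h2

/-- For fixed `c`, each of `c < hit` and `hit < c` is a strict sign condition on `gap` at time `c`,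
hence open in the parameters within `region`. -/
theorem continuousOn_hit : ContinuousOn (fun q : ℝ × ℝ => hit q.1 q.2) region := by
  intro q hq
  obtain ⟨h1, h2, h3⟩ := hq
  refine tendsto_order.2 ⟨fun c hc => ?_, fun c hc => ?_⟩
  · rcases lt_or_ge c 0 with h0 | h0
    · exact Eventually.of_forall fun q' => h0.trans_le (hit_nonneg _ _)
    · have hg := (gap_neg_iff h1 h2 h3 h0).2 hc
      have := (continuousAt_gap h0 h1.le).eventually_lt_const hg
      filter_upwards [mem_nhdsWithin_of_mem_nhds this, self_mem_nhdsWithin] with q' hq' hr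
      exact (gap_neg_iff hr.1 hr.2.1 hr.2.2 h0).1 hq'
  · have h0 : 0 ≤ c := (hit_nonneg _ _).trans hc.le
    have hg := (gap_pos_iff h1 h2 h3 h0).2 hc
    have := (continuousAt_gap h0 h1.le).eventually_const_lt hg
    filter_upwards [mem_nhdsWithin_of_mem_nhds this, self_mem_nhdsWithin] with q' hgap hr
    exact (gap_pos_iff hr.1 hr.2.1 hr.2.2 h0).1 hgap

/-! ### Orbits through one exchange -/

/-- The position at time `t` of the orbit that starts at `conf r i j M v`, valid until the second
exchange of the leading point. -/
def run (r : Bool) (i j : Fin 3) (M v t : ℝ) : Pairs :=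
  if t ≤ hit M v then conf r i j (growth M t) (v + travel M t)
  else conf (!r) (i + 1) i (growth M t) (v + travel M t - 2 * growth M (hit M v))

theorem run_of_le {r : Bool} {i j : Fin 3} {M v t : ℝ} (ht : t ≤ hit M v) :
    run r i j M v t = conf r i j (growth M t) (v + travel M t) := if_pos ht

theorem conf_hit (r : Bool) (i j : Fin 3) {M v : ℝ} (hM : 0 < M) (hM1 : M ≤ 1) (hv : v ≤ M) :
    conf r i j (growth M (hit M v)) (v + travel M (hit M v)) =
      conf (!r) (i + 1) i (growth M (hit M v))
        (v + travel M (hit M v) - 2 * growth M (hit M v)) := by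
  have h := gap_hit hM hM1 hv
  rw [gap, sub_eq_zero] at h
  rw [h, conf_tie r i j (growth_pos hM (hit_nonneg M v)).le]
  congr 1
  ring

theorem run_of_ge {r : Bool} {i j : Fin 3} {M v t : ℝ} (hM : 0 < M) (hM1 : M ≤ 1) (hv : v ≤ M)
    (ht : hit M v ≤ t) :
    run r i j M v t =
      conf (!r) (i + 1) i (growth M t) (v + travel M t - 2 * growth M (hit M v)) := by
  rcases ht.eq_or_lt with h | h
  · rw [run_of_le h.ge, ← h, conf_hit r i j hM hM1 hv]
  · rw [run, if_neg (not_le.2 h)]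

theorem run_zero (r : Bool) (i j : Fin 3) (M v : ℝ) : run r i j M v 0 = conf r i j M v := by
  rw [run_of_le (hit_nonneg M v), growth_zero, travel_zero, add_zero]

theorem adm_before_hit {i j : Fin 3} {M v t : ℝ} (h : Adm i j M v) (h0 : 0 ≤ t)
    (ht : t ≤ hit M v) : Adm i j (growth M t) (v + travel M t) := by
  have h1 := le_growth h.pos h.le_one h0
  have h2 := travel_nonneg h.pos h0
  refine ⟨growth_pos h.pos h0, growth_le_one h.pos h.le_one h0, by linarith [h.neg_le], ?_, h.ne,
    fun hj => by linarith [h.lt hj]⟩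
  have := (gap_pos_iff h.pos h.le_one h.le h0).not.2 ht.not_gt
  unfold gap at this
  linarith

/-- After the exchange at norm g the trailing coordinate starts at -g and must travel at least 2g
before the next tie. In time s it travels at most g (exp s - 1), which is below 2g for s < log 3. -/
theorem adm_after_hit {i j : Fin 3} {M v t : ℝ} (h : Adm i j M v)
    (ht : hit M v ≤ t) (ht' : t < hit M v + Real.log 3) :
    Adm (i + 1) i (growth M t) (v + travel M t - 2 * growth M (hit M v)) ∧
      v + travel M t - 2 * growth M (hit M v) < growth M t := by
  have h0 := hit_nonneg M v
  have hg := gap_hit h.pos h.le_one h.le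
  unfold gap at hg
  have h1 := growth_mono h.pos h.le_one h0 ht
  have h2 := travel_mono h.pos h0 ht
  have h3 := travel_sub_le h.pos h0 (h0.trans ht)
  have h4 := growth_pos h.pos h0
  have h5 : Real.exp (t - hit M v) < 3 := by
    rw [← Real.lt_log_iff_exp_lt (by norm_num)]; linarith
  have h6 : v + travel M t - 2 * growth M (hit M v) < growth M t := by nlinarith
  exact ⟨⟨growth_pos h.pos (h0.trans ht), growth_le_one h.pos h.le_one (h0.trans ht), by linarith,
    h6.le, fin_ne_add_two i, fun hi => absurd hi (fin_ne_add_one i)⟩, h6⟩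

theorem one_lt_log_three : 1 < Real.log 3 := by
  rw [Real.lt_log_iff_exp_lt (by norm_num)]
  exact Real.exp_one_lt_three

theorem run_mem_Config (r : Bool) {i j : Fin 3} {M v t : ℝ} (h : Adm i j M v) (h0 : 0 ≤ t)
    (ht : t < Real.log 3) : run r i j M v t ∈ Config := by
  rcases le_total t (hit M v) with h1 | h1
  · rw [run_of_le h1]
    exact conf_mem_Config r (adm_before_hit h h0 h1)
  · rw [run_of_ge h.pos h.le_one h.le h1]
    exact conf_mem_Config _ (adm_after_hit h h1 (by linarith [hit_nonneg M v])).1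

theorem norm_run (r : Bool) {i j : Fin 3} {M v t : ℝ} (h : Adm i j M v) (h0 : 0 ≤ t)
    (ht : t < Real.log 3) : ‖run r i j M v t‖ = growth M t := by
  rcases le_total t (hit M v) with h1 | h1
  · rw [run_of_le h1]
    exact norm_conf r (adm_before_hit h h0 h1)
  · rw [run_of_ge h.pos h.le_one h.le h1]
    exact norm_conf _ (adm_after_hit h h1 (by linarith [hit_nonneg M v])).1

/-- The parameters for which `run` is continuous. -/
def runDomain : Set ((ℝ × ℝ) × ℝ) := {q | q.1 ∈ region ∧ 0 ≤ q.2}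

/-- The two formulas are pasted along `t = hit M v`, where `conf_hit` makes them agree. -/
theorem continuous_run (r : Bool) (i j : Fin 3) :
    Continuous (fun q : runDomain => run r i j q.1.1.1 q.1.1.2 q.1.2) := by
  have hM : Continuous (fun q : runDomain => q.1.1.1) := by fun_prop
  have hv : Continuous (fun q : runDomain => q.1.1.2) := by fun_prop
  have ht : Continuous (fun q : runDomain => q.1.2) := by fun_prop
  have hh : Continuous (fun q : runDomain => hit q.1.1.1 q.1.1.2) :=
    continuousOn_hit.comp_continuous (f := fun q : runDomain => q.1.1) (by fun_prop)
      fun q => q.2.1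
  have hg : Continuous (fun q : runDomain => growth q.1.1.1 q.1.2) :=
    continuous_iff_continuousAt.2 fun q => ContinuousAt.comp
      (f := fun q : runDomain => (q.1.1.1, q.1.2)) (g := fun q : ℝ × ℝ => growth q.1 q.2)
      (continuousAt_growth q.2.1.1.le q.2.2) (by fun_prop)
  have htr : Continuous (fun q : runDomain => travel q.1.1.1 q.1.2) :=
    continuous_iff_continuousAt.2 fun q => ContinuousAt.comp
      (f := fun q : runDomain => (q.1.1.1, q.1.2)) (g := fun q : ℝ × ℝ => travel q.1 q.2)
      (continuousAt_travel q.2.1.1.le q.2.2) (by fun_prop)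
  have hgh : Continuous (fun q : runDomain => growth q.1.1.1 (hit q.1.1.1 q.1.1.2)) :=
    continuous_iff_continuousAt.2 fun q => ContinuousAt.comp
      (f := fun q : runDomain => (q.1.1.1, hit q.1.1.1 q.1.1.2))
      (g := fun q : ℝ × ℝ => growth q.1 q.2)
      (continuousAt_growth q.2.1.1.le (hit_nonneg _ _)) (by fun_prop)
  refine Continuous.if_le ?_ ?_ ht hh ?_
  · exact (continuous_conf r i j).comp (hg.prodMk (hv.add htr))
  · exact (continuous_conf (!r) (i + 1) i).comp
      (hg.prodMk ((hv.add htr).sub (continuous_const.mul hgh)))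
  · rintro ⟨⟨⟨M, v⟩, t⟩, ⟨h1, h2, h3⟩, h4⟩ hq
    simp only at hq h1 h2 h3 ⊢
    rw [hq]
    exact conf_hit r i j h1 h2 h3

/-! ### Forward orbits of the field -/

theorem hasDerivWithinAt_pack (r : Bool) {f g : ℝ → Fin 3 → ℝ} {f' g' : Fin 3 → ℝ} {s : Set ℝ}
    {t : ℝ} (hf : HasDerivWithinAt f f' s t) (hg : HasDerivWithinAt g g' s t) :
    HasDerivWithinAt (fun u => pack r (f u) (g u)) (pack r f' g') s t := by
  cases r
  · exact hf.prodMk hg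
  · exact hg.prodMk hf

/-- `leg` has a kink at 0. The right derivative survives because `hmono` keeps a coordinate that
starts at 0 on the nonnegative side. -/
theorem hasDerivWithinAt_conf (r : Bool) (i j : Fin 3) {μ ν : ℝ → ℝ} {μ' ν' t : ℝ}
    (hμ : HasDerivWithinAt μ μ' (Ici t) t) (hν : HasDerivWithinAt ν ν' (Ici t) t)
    (hmono : ∀ s ∈ Ici t, ν t ≤ ν s) :
    HasDerivWithinAt (fun s => conf r i j (μ s) (ν s))
      (pack r (μ' • e i) (if ν t < 0 then (-ν') • e j else ν' • e (i + 1))) (Ici t) t := by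
  refine hasDerivWithinAt_pack r (hμ.smul_const (e i)) ?_
  split_ifs with h
  · refine (hν.neg.smul_const (e j)).congr_of_eventuallyEq ?_ (leg_of_nonpos i j h.le)
    filter_upwards [hν.continuousWithinAt.eventually_lt_const h] with s hs
    exact leg_of_nonpos i j hs.le
  · rw [not_lt] at h
    exact (hν.smul_const (e (i + 1))).congr (fun s hs => leg_of_nonneg i j (h.trans (hmono s hs)))
      (leg_of_nonneg i j h)

theorem hasDerivWithinAt_run (r : Bool) {i j : Fin 3} {M v t : ℝ} (h : Adm i j M v) (h0 : 0 ≤ t)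
    (ht : t < Real.log 3) {p : Config} (hp : (p : Pairs) = run r i j M v t) :
    HasDerivWithinAt (run r i j M v) (circulatingField p) (Ici t) t := by
  have hg := (hasDerivAt_growth h.pos h0).hasDerivWithinAt (s := Ici t)
  have htr := (hasDerivAt_travel h.pos h0).hasDerivWithinAt (s := Ici t)
  rcases lt_or_ge t (hit M v) with h1 | h1
  · rw [run_of_le h1.le] at hp
    have hlt := (gap_neg_iff h.pos h.le_one h.le h0).2 h1
    unfold gap at hlt
    rw [circulatingField_conf (adm_before_hit h h0 h1.le) (by linarith) hp]
    have hmono : ∀ s ∈ Ici t, v + travel M t ≤ v + travel M s := fun s hs => by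
      linarith [travel_mono h.pos h0 hs]
    refine (hasDerivWithinAt_conf r i j hg (htr.const_add v) hmono).congr_of_eventuallyEq
      ?_ (run_of_le h1.le)
    filter_upwards [mem_nhdsWithin_of_mem_nhds (Iio_mem_nhds h1)] with s hs
    exact run_of_le (le_of_lt hs)
  · rw [run_of_ge h.pos h.le_one h.le h1] at hp
    obtain ⟨h2, h3⟩ := adm_after_hit h h1 (by linarith [hit_nonneg M v])
    rw [circulatingField_conf h2 h3 hp]
    exact (hasDerivWithinAt_conf (!r) (i + 1) i hg
      ((htr.const_add v).sub_const (2 * growth M (hit M v))) fun s hs =>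
        (by linarith [travel_mono h.pos h0 hs] :
          v + travel M t - 2 * growth M (hit M v) ≤ v + travel M s - 2 * growth M (hit M v))).congr
      (fun s hs => run_of_ge h.pos h.le_one h.le (h1.trans hs)) (run_of_ge h.pos h.le_one h.le h1)

/-- A solution of the equations of motion in a chart is given by `growth` and `travel`. -/
theorem chart_solution_unique {μ ν : ℝ → ℝ} {a b : ℝ} (hab : a ≤ b) (hμc : ContinuousOn μ (Icc a b))
    (hνc : ContinuousOn ν (Icc a b)) (hpos : ∀ t ∈ Icc a b, 0 < μ t)
    (hμ : ∀ t ∈ Ico a b, HasDerivWithinAt μ (μ t * (1 - μ t)) (Ici t) t)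
    (hν : ∀ t ∈ Ico a b, HasDerivWithinAt ν (μ t) (Ici t) t) :
    ∀ t ∈ Icc a b, μ t = growth (μ a) (t - a) ∧ ν t = ν a + travel (μ a) (t - a) := by
  have ha : a ∈ Icc a b := left_mem_Icc.2 hab
  have hexp : ∀ t, HasDerivWithinAt (fun s => Real.exp (s - a)) (Real.exp (t - a)) (Ici t) t :=
    fun t => by
      have := ((hasDerivAt_id t).sub_const a).exp.hasDerivWithinAt (s := Ici t)
      simpa using this
  -- A first integral of the logistic equation: (1/μ - 1) exp (t - a) is constant.
  have h1 : ∀ t ∈ Icc a b, (μ t)⁻¹ * Real.exp (t - a) - Real.exp (t - a) =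
      (μ a)⁻¹ * Real.exp (a - a) - Real.exp (a - a) := by
    refine constant_of_has_deriv_right_zero (f := fun t => (μ t)⁻¹ * Real.exp (t - a) -
      Real.exp (t - a)) ?_ fun t ht => ?_
    · exact ((hμc.inv₀ fun t ht => (hpos t ht).ne').mul (by fun_prop)).sub (by fun_prop)
    · have hp := hpos t (Ico_subset_Icc_self ht)
      refine ((((hμ t ht).inv hp.ne').mul (hexp t)).sub (hexp t)).congr_deriv ?_
      simp only [Pi.inv_apply]
      field_simp
      ring
  have h2 : ∀ t ∈ Icc a b, μ t = growth (μ a) (t - a) := fun t ht => by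
    have h := h1 t ht
    have hp := hpos t ht
    have hpa := hpos a ha
    have hd := denom_pos hpa.le (sub_nonneg.2 ht.1)
    rw [growth, eq_div_iff hd.ne', denom]
    simp only [sub_self, Real.exp_zero] at h
    field_simp at h
    linarith
  have h3 : ∀ t ∈ Icc a b, ν t - travel (μ a) (t - a) = ν a - travel (μ a) (a - a) := by
    refine constant_of_has_deriv_right_zero (f := fun t => ν t - travel (μ a) (t - a)) ?_
      fun t ht => ?_
    · refine hνc.sub fun t ht => ContinuousAt.continuousWithinAt ?_
      exact ContinuousAt.comp (f := fun t => t - a) (hasDerivAt_travel (hpos a ha)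
        (sub_nonneg.2 ht.1)).continuousAt (by fun_prop)
    · have := ((hasDerivAt_travel (hpos a ha) (sub_nonneg.2 ht.1)).comp_sub_const t a)
      refine ((hν t ht).sub this.hasDerivWithinAt).congr_deriv ?_
      rw [h2 t (Ico_subset_Icc_self ht), sub_self]
  intro t ht
  refine ⟨h2 t ht, ?_⟩
  have := h3 t ht
  rw [sub_self, travel_zero] at this
  linarith

/-! ### Uniqueness of forward orbits -/

/-- The leading component of a pair. -/
def lead (r : Bool) (p : Pairs) : Fin 3 → ℝ := bif r then p.2 else p.1

/-- The trailing component of a pair. -/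
def trail (r : Bool) (p : Pairs) : Fin 3 → ℝ := bif r then p.1 else p.2

theorem pack_lead_trail (r : Bool) (p : Pairs) : pack r (lead r p) (trail r p) = p := by
  cases r <;> rfl

theorem lead_pack (r : Bool) (a b : Fin 3 → ℝ) : lead r (pack r a b) = a := by
  cases r <;> rfl

theorem trail_pack (r : Bool) (a b : Fin 3 → ℝ) : trail r (pack r a b) = b := by
  cases r <;> rfl

theorem continuous_lead (r : Bool) : Continuous (lead r) := by
  cases r
  · exact continuous_fst
  · exact continuous_snd

theorem continuous_trail (r : Bool) : Continuous (trail r) := by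
  cases r
  · exact continuous_snd
  · exact continuous_fst

theorem HasDerivWithinAt.lead_apply (r : Bool) (k : Fin 3) {f : ℝ → Pairs} {f' : Pairs} {s : Set ℝ}
    {t : ℝ} (h : HasDerivWithinAt f f' s t) :
    HasDerivWithinAt (fun u => lead r (f u) k) (lead r f' k) s t := by
  cases r
  · exact hasDerivWithinAt_pi.1 ((hasFDerivAt_fst (𝕜 := ℝ)).comp_hasDerivWithinAt t h) k
  · exact hasDerivWithinAt_pi.1 ((hasFDerivAt_snd (𝕜 := ℝ)).comp_hasDerivWithinAt t h) k

theorem HasDerivWithinAt.trail_apply (r : Bool) (k : Fin 3) {f : ℝ → Pairs} {f' : Pairs}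
    {s : Set ℝ} {t : ℝ} (h : HasDerivWithinAt f f' s t) :
    HasDerivWithinAt (fun u => trail r (f u) k) (trail r f' k) s t := by
  cases r
  · exact hasDerivWithinAt_pi.1 ((hasFDerivAt_snd (𝕜 := ℝ)).comp_hasDerivWithinAt t h) k
  · exact hasDerivWithinAt_pi.1 ((hasFDerivAt_fst (𝕜 := ℝ)).comp_hasDerivWithinAt t h) k

/-- A function with positive right derivative is eventually at least its value. -/
theorem eventually_lt_of_hasDerivWithinAt {f : ℝ → ℝ} {f' t : ℝ}
    (h : HasDerivWithinAt f f' (Ici t) t) (hf' : 0 < f') : ∀ᶠ s in 𝓝[>] t, f t < f s := by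
  have h1 := hasDerivWithinAt_iff_tendsto_slope.1 h
  rw [Ici_sdiff_left] at h1
  filter_upwards [h1.eventually_const_lt hf', self_mem_nhdsWithin] with s hs hts
  rw [slope_def_field] at hs
  have := (div_pos_iff_of_pos_right (sub_pos.2 hts)).1 hs
  linarith

theorem eventually_nhdsGE_of_nhdsGT {P : ℝ → Prop} {t : ℝ} (ht : P t) (h : ∀ᶠ s in 𝓝[>] t, P s) :
    ∀ᶠ s in 𝓝[≥] t, P s := by
  rw [← Ioi_insert, nhdsWithin_insert, eventually_sup]
  exact ⟨by simpa using ht, h⟩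

/-- A forward orbit stays for a while in the half-open chart of its position. -/
theorem IsForwardSolution.eventually_mem_chart {T : ℝ} {γ : ℝ → Config}
    (hγ : IsForwardSolution circulatingField T γ) {t₀ : ℝ} (ht₀ : t₀ ∈ Ico 0 T) {r : Bool}
    {i j : Fin 3} {M v : ℝ} (h : Adm i j M v) (hv : v < M)
    (h₀ : (γ t₀ : Pairs) = conf r i j M v) :
    ∀ᶠ t in 𝓝[≥] t₀, ∃ μ ν, Adm i j μ ν ∧ ν < μ ∧ (γ t : Pairs) = conf r i j μ ν := by
  refine eventually_nhdsGE_of_nhdsGT ⟨M, v, h, hv, h₀⟩ ?_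
  have hM := h.pos
  have hd := hγ.2 t₀ ht₀
  rw [circulatingField_conf h hv h₀] at hd
  have hL := fun k => HasDerivWithinAt.lead_apply r k hd
  have hR := fun k => HasDerivWithinAt.trail_apply r k hd
  simp only [lead_pack, trail_pack] at hL hR
  have hLc := fun k => (hL k).continuousWithinAt
  have hRc := fun k => (hR k).continuousWithinAt
  have hle : 𝓝[>] t₀ ≤ 𝓝[≥] t₀ := nhdsWithin_mono _ Ioi_subset_Ici_self
  have hL0 : lead r (γ t₀ : Pairs) i = M := by
    rw [h₀, conf, lead_pack, smul_e_apply, if_pos rfl]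
  have hR0 : trail r (γ t₀ : Pairs) = leg i j v := by rw [h₀, conf, trail_pack]
  have hgr : ∀ t, lead r (γ t : Pairs) ∈ graph ∧ trail r (γ t : Pairs) ∈ graph := fun t => by
    have := (γ t).2
    rw [← pack_lead_trail r (γ t : Pairs), pack_mem_Config] at this
    exact ⟨this.1, this.2.1⟩
  have hLpos : ∀ᶠ t in 𝓝[>] t₀, 0 < lead r (γ t : Pairs) i :=
    hle ((hLc i).eventually_const_lt (by beta_reduce; rw [hL0]; exact hM))
  rcases lt_or_ge v 0 with hv0 | hv0
  · have hRj : trail r (γ t₀ : Pairs) j = -v := by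
      rw [hR0, leg_of_nonpos i j hv0.le, smul_e_apply, if_pos rfl]
    have hRpos : ∀ᶠ t in 𝓝[>] t₀, 0 < trail r (γ t : Pairs) j :=
      hle ((hRc j).eventually_const_lt (by beta_reduce; rw [hRj]; linarith))
    have hcmp : ∀ᶠ t in 𝓝[>] t₀, trail r (γ t : Pairs) j < lead r (γ t : Pairs) i := by
      rcases h.neg_le.eq_or_lt with heq | hlt
      · have hij : j ≠ i := fun hji => (h.lt hji).ne heq
        -- In a tie, continuity does not tell who leads next; the difference of the distances has
        -- right derivative M (1 - M) + M > 0, so the named leader pulls ahead.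
        have hsub := (hL i).sub (hR j)
        have hev := eventually_lt_of_hasDerivWithinAt hsub (by
          rw [if_pos hv0, smul_e_apply, smul_e_apply, if_pos rfl, if_pos rfl]
          nlinarith [h.le_one])
        filter_upwards [hev] with t ht
        simp only [Pi.sub_apply, hL0, hRj] at ht
        linarith
      · exact hle ((hRc j).eventually_lt (hLc i) (by beta_reduce; rw [hL0, hRj]; linarith))
    filter_upwards [hLpos, hRpos, hcmp] with t h1 h2 h3
    refine ⟨lead r (γ t : Pairs) i, -trail r (γ t : Pairs) j,
      ⟨h1, (mem_Icc_of_mem_graph (hgr t).1 i).2, by linarith, by linarith, h.ne,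
        fun _ => by linarith⟩, by linarith, ?_⟩
    rw [conf, leg_of_nonpos i j (by linarith), neg_neg, ← eq_smul_of_mem_graph (hgr t).1 h1.ne',
      ← eq_smul_of_mem_graph (hgr t).2 h2.ne', pack_lead_trail]
  · have hRj : trail r (γ t₀ : Pairs) (i + 1) = v := by
      rw [hR0, leg_of_nonneg i j hv0, smul_e_apply, if_pos rfl]
    have hRpos : ∀ᶠ t in 𝓝[>] t₀, 0 < trail r (γ t : Pairs) (i + 1) := by
      -- This covers `v = 0`: from the centre, the positive velocity forces the trailing point onto
      -- edge `i + 1`.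
      have hev := eventually_lt_of_hasDerivWithinAt (hR (i + 1)) (by
        rw [if_neg hv0.not_gt, smul_e_apply, if_pos rfl]; exact hM)
      filter_upwards [hev] with t ht
      rw [hRj] at ht
      linarith
    have hcmp : ∀ᶠ t in 𝓝[>] t₀, trail r (γ t : Pairs) (i + 1) < lead r (γ t : Pairs) i :=
      hle ((hRc (i + 1)).eventually_lt (hLc i) (by beta_reduce; rw [hL0, hRj]; exact hv))
    filter_upwards [hLpos, hRpos, hcmp] with t h1 h2 h3
    refine ⟨lead r (γ t : Pairs) i, trail r (γ t : Pairs) (i + 1),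
      ⟨h1, (mem_Icc_of_mem_graph (hgr t).1 i).2, by linarith, by linarith, h.ne,
        fun _ => by linarith⟩, by linarith, ?_⟩
    rw [conf, leg_of_nonneg i j (by linarith), ← eq_smul_of_mem_graph (hgr t).1 h1.ne',
      ← eq_smul_of_mem_graph (hgr t).2 h2.ne', pack_lead_trail]

theorem lead_conf (r : Bool) (i j : Fin 3) (M v : ℝ) : lead r (conf r i j M v) i = M := by
  rw [conf, lead_pack, smul_e_apply, if_pos rfl]

/-- The coordinate `v` of `conf r i j M v`. -/
def offset (r : Bool) (i j : Fin 3) (p : Pairs) : ℝ := trail r p (i + 1) - trail r p j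

theorem offset_conf (r : Bool) {i j : Fin 3} (hj : j ≠ i + 1) (M v : ℝ) :
    offset r i j (conf r i j M v) = v := by
  rw [offset, conf, trail_pack, leg_coord hj]

theorem continuous_offset (r : Bool) (i j : Fin 3) : Continuous (offset r i j) := by
  have := continuous_trail r
  unfold offset
  fun_prop

/-- A forward orbit is locally given by `growth` and `travel`. -/
theorem IsForwardSolution.eventually_eq_conf {T : ℝ} {γ : ℝ → Config}
    (hγ : IsForwardSolution circulatingField T γ) {t₀ : ℝ} (ht₀ : t₀ ∈ Ico 0 T) {r : Bool}
    {i j : Fin 3} {M v : ℝ} (h : Adm i j M v) (hv : v < M)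
    (h₀ : (γ t₀ : Pairs) = conf r i j M v) :
    ∀ᶠ t in 𝓝[≥] t₀,
      (γ t : Pairs) = conf r i j (growth M (t - t₀)) (v + travel M (t - t₀)) := by
  obtain ⟨b, hb, hbsub⟩ := mem_nhdsGE_iff_exists_Icc_subset.1
    ((hγ.eventually_mem_chart ht₀ h hv h₀).and
      (mem_nhdsWithin_of_mem_nhds (Iio_mem_nhds ht₀.2) : ∀ᶠ t in 𝓝[≥] t₀, t < T))
  have hb' : t₀ < b := hb
  have hchart := fun t ht => (hbsub ht : _ ∧ t < T).1
  have hsub : Icc t₀ b ⊆ Ico 0 T := fun t ht => ⟨ht₀.1.trans ht.1, (hbsub ht : _ ∧ t < T).2⟩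
  have hc : ContinuousOn (fun t => (γ t : Pairs)) (Icc t₀ b) :=
    continuous_subtype_val.comp_continuousOn (hγ.1.mono hsub)
  have key := chart_solution_unique (μ := fun t => lead r (γ t : Pairs) i)
    (ν := fun t => offset r i j (γ t : Pairs)) hb'.le
    (((continuous_apply i).comp (continuous_lead r)).comp_continuousOn hc)
    ((continuous_offset r i j).comp_continuousOn hc)
    (fun t ht => by
      obtain ⟨μ, ν, h1, h2, h3⟩ := hchart t ht
      simp only [h3, lead_conf]
      exact h1.pos)
    (fun t ht => by
      obtain ⟨μ, ν, h1, h2, h3⟩ := hchart t (Ico_subset_Icc_self ht)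
      have hd := hγ.2 t (hsub (Ico_subset_Icc_self ht))
      rw [circulatingField_conf h1 h2 h3] at hd
      refine (HasDerivWithinAt.lead_apply r i hd).congr_deriv ?_
      rw [h3, lead_conf, lead_pack, smul_e_apply, if_pos rfl])
    (fun t ht => by
      obtain ⟨μ, ν, h1, h2, h3⟩ := hchart t (Ico_subset_Icc_self ht)
      have hd := hγ.2 t (hsub (Ico_subset_Icc_self ht))
      rw [circulatingField_conf h1 h2 h3] at hd
      refine ((HasDerivWithinAt.trail_apply r (i + 1) hd).sub
        (HasDerivWithinAt.trail_apply r j hd)).congr_deriv ?_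
      rw [h3, lead_conf, trail_pack]
      split_ifs
      · rw [smul_e_apply, smul_e_apply, if_pos rfl, if_neg h.ne.symm]; ring
      · rw [smul_e_apply, smul_e_apply, if_pos rfl, if_neg h.ne]; ring)
  have hmem : Icc t₀ b ∈ 𝓝[≥] t₀ := Icc_mem_nhdsGE hb'
  filter_upwards [hmem] with t ht
  obtain ⟨μ, ν, h1, h2, h3⟩ := hchart t ht
  obtain ⟨k1, k2⟩ := key t ht
  simp only [h₀, h3, lead_conf, offset_conf r h.ne] at k1 k2
  rw [h3, k1, k2]

/-- Forward orbits are determined by their starting points. -/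
theorem IsForwardSolution.eqOn {T : ℝ} {γ₁ γ₂ : ℝ → Config}
    (h₁ : IsForwardSolution circulatingField T γ₁) (h₂ : IsForwardSolution circulatingField T γ₂)
    (h₀ : γ₁ 0 = γ₂ 0) : EqOn γ₁ γ₂ (Ico 0 T) := by
  intro t ht
  have hsub : Icc 0 t ⊆ Ico 0 T := fun s hs => ⟨hs.1, hs.2.trans_lt ht.2⟩
  have hclosed : IsClosed ({s | γ₁ s = γ₂ s} ∩ Icc 0 t) := by
    have : {s | γ₁ s = γ₂ s} ∩ Icc 0 t =
        Icc 0 t ∩ (fun s => (γ₁ s, γ₂ s)) ⁻¹' {q | q.1 = q.2} := by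
      ext s; simp [and_comm]
    rw [this]
    exact ((h₁.1.mono hsub).prodMk (h₂.1.mono hsub)).preimage_isClosed_of_isClosed isClosed_Icc
      (isClosed_eq continuous_fst continuous_snd)
  -- Real induction: the coincidence set is closed, and it extends to the right of each of its
  -- points because both orbits follow the same chart formula.
  refine hclosed.Icc_subset_of_forall_mem_nhdsWithin h₀ (fun s hs => ?_) (right_mem_Icc.2 ht.1)
  obtain ⟨r, i, j, M, v, h, hv, hp⟩ := exists_conf (γ₁ s).2
  have hs' := hsub (Ico_subset_Icc_self hs.2)
  have e₁ := h₁.eventually_eq_conf hs' h hv hp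
  have e₂ := h₂.eventually_eq_conf hs' h hv (by rw [← hs.1]; exact hp)
  filter_upwards [nhdsWithin_mono _ Ioi_subset_Ici_self e₁,
    nhdsWithin_mono _ Ioi_subset_Ici_self e₂] with u hu₁ hu₂
  exact Subtype.ext (hu₁.trans hu₂.symm)

/-! ### The semiflow -/

open Classical in
/-- The curve `run` in the configuration space. -/
def runCurve (r : Bool) {i j : Fin 3} {M v : ℝ} (h : Adm i j M v) (t : ℝ) : Config :=
  if ht : run r i j M v t ∈ Config then ⟨run r i j M v t, ht⟩ else ⟨_, conf_mem_Config r h⟩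

theorem coe_runCurve (r : Bool) {i j : Fin 3} {M v : ℝ} (h : Adm i j M v) {t : ℝ} (h0 : 0 ≤ t)
    (ht : t < Real.log 3) : (runCurve r h t : Pairs) = run r i j M v t := by
  rw [runCurve, dif_pos (run_mem_Config r h h0 ht)]

theorem runCurve_zero (r : Bool) {i j : Fin 3} {M v : ℝ} (h : Adm i j M v) :
    (runCurve r h 0 : Pairs) = conf r i j M v := by
  rw [coe_runCurve r h le_rfl (zero_lt_one.trans one_lt_log_three), run_zero]

theorem Adm.mem_region {i j : Fin 3} {M v : ℝ} (h : Adm i j M v) : (M, v) ∈ region :=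
  ⟨h.pos, h.le_one, h.le⟩

theorem isForwardSolution_runCurve (r : Bool) {i j : Fin 3} {M v : ℝ} (h : Adm i j M v) :
    IsForwardSolution circulatingField (Real.log 3) (runCurve r h) := by
  refine ⟨?_, fun t ht => ?_⟩
  · rw [Topology.IsInducing.subtypeVal.continuousOn_iff]
    have h1 : ContinuousOn (run r i j M v) (Ico 0 (Real.log 3)) := by
      rw [continuousOn_iff_continuous_domRestrict]
      exact (continuous_run r i j).comp (f := fun t : Ico 0 (Real.log 3) =>
        (⟨((M, v), t), h.mem_region, t.2.1⟩ : runDomain)) (by fun_prop)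
    exact h1.congr fun t ht => coe_runCurve r h ht.1 ht.2
  · refine (hasDerivWithinAt_run r h ht.1 ht.2 (coe_runCurve r h ht.1 ht.2)).congr_of_eventuallyEq
      ?_ (coe_runCurve r h ht.1 ht.2)
    filter_upwards [self_mem_nhdsWithin, mem_nhdsWithin_of_mem_nhds (Iio_mem_nhds ht.2)]
      with s hs hlog
    exact coe_runCurve r h (ht.1.trans hs) hlog

/-- The time-`t` map for `t ≤ 1`; later times are replaced by `1`. -/
def step (t : ℝ≥0) (p : Config) : Config :=
  runCurve (exists_conf p.2).choose
    (exists_conf p.2).choose_spec.choose_spec.choose_spec.choose_spec.choose_spec.1 (min t 1 : ℝ≥0)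

/-- The chosen chart does not matter: any two charts of `p` yield forward orbits from `p`, which
agree by uniqueness. In particular closed charts are allowed, as continuity requires. -/
theorem step_eq_run {r : Bool} {i j : Fin 3} {M v : ℝ} (h : Adm i j M v) {p : Config}
    (hp : (p : Pairs) = conf r i j M v) (t : ℝ≥0) :
    (step t p : Pairs) = run r i j M v (min t 1 : ℝ≥0) := by
  have h3 := (exists_conf p.2).choose_spec.choose_spec.choose_spec.choose_spec.choose_spec.2.2
  have ht : ((min t 1 : ℝ≥0) : ℝ) ∈ Ico 0 (Real.log 3) :=
    ⟨(min t 1).2, lt_of_le_of_lt (by exact_mod_cast min_le_right t 1) one_lt_log_three⟩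
  rw [← coe_runCurve r h ht.1 ht.2]
  congr 1
  exact IsForwardSolution.eqOn (isForwardSolution_runCurve _ _) (isForwardSolution_runCurve r h)
    (Subtype.ext (by rw [runCurve_zero, runCurve_zero, ← hp]; exact h3.symm)) ht

theorem step_zero (p : Config) : step 0 p = p := by
  obtain ⟨r, i, j, M, v, h, -, hp⟩ := exists_conf p.2
  apply Subtype.ext
  rw [step_eq_run h hp, hp, min_eq_left zero_le_one, NNReal.coe_zero, run_zero]

theorem step_of_one_le {t : ℝ≥0} (ht : 1 ≤ t) (p : Config) : step t p = step 1 p := by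
  unfold step
  rw [min_eq_right ht, min_self]

/-! ### Continuity of the unit step -/

/-- The configurations in a closed chart. -/
def chartSet (k : Bool × Fin 3 × Fin 3) : Set Config :=
  {p | k.2.2 ≠ k.2.1 + 1 ∧
    (p : Pairs) = conf k.1 k.2.1 k.2.2 ‖(p : Pairs)‖ (offset k.1 k.2.1 k.2.2 p) ∧
    |offset k.1 k.2.1 k.2.2 p| ≤ ‖(p : Pairs)‖}

/-- The parameters are recovered continuously as norm and `offset`, so only equations and weak
inequalities are imposed. -/
theorem isClosed_chartSet (k : Bool × Fin 3 × Fin 3) : IsClosed (chartSet k) := by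
  have h1 : Continuous (fun p : Config => offset k.1 k.2.1 k.2.2 p) :=
    (continuous_offset _ _ _).comp continuous_subtype_val
  have h2 : Continuous (fun p : Config => ‖(p : Pairs)‖) := continuous_subtype_val.norm
  exact isClosed_const.and ((isClosed_eq continuous_subtype_val
    ((continuous_conf _ _ _).comp (h2.prodMk h1))).and (isClosed_le h1.abs h2))

theorem exists_mem_chartSet (p : Config) : ∃ k, p ∈ chartSet k := by
  obtain ⟨r, i, j, M, v, h, -, hp⟩ := exists_conf p.2
  refine ⟨(r, i, j), h.ne, ?_, ?_⟩
  · rw [hp, offset_conf r h.ne, norm_conf r h]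
  · rw [hp, offset_conf r h.ne, norm_conf r h]
    exact h.abs_le

/-- The strict inequality required for `j = i` is automatic: equality would put both points at the
same place. -/
theorem adm_of_mem_chartSet {k : Bool × Fin 3 × Fin 3} {p : Config} (hp : p ∈ chartSet k) :
    Adm k.2.1 k.2.2 ‖(p : Pairs)‖ (offset k.1 k.2.1 k.2.2 p) := by
  obtain ⟨h1, h2, h3⟩ := hp
  rw [abs_le] at h3
  have hpos := norm_pos_of_mem_Config p.2
  refine ⟨hpos, norm_le_one_of_mem_Config p.2, h3.1, h3.2, h1, fun h => ?_⟩
  refine lt_of_le_of_ne h3.1 fun heq => ?_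
  have hc := p.2
  rw [h2, ← heq, conf, leg_of_nonpos _ _ (by linarith), neg_neg, pack_mem_Config, h] at hc
  exact hc.2.2 rfl

/-- The closed charts form a finite closed cover, and on each of them the step is `run` in
continuous parameters. -/
theorem continuous_step : Continuous (Function.uncurry step) := by
  refine (locallyFinite_of_finite
    (fun k : Bool × Fin 3 × Fin 3 => {q : ℝ≥0 × Config | q.2 ∈ chartSet k})).continuous ?_ ?_ ?_
  · exact eq_univ_of_forall fun q => mem_iUnion.2 (exists_mem_chartSet q.2)
  · exact fun k => (isClosed_chartSet k).preimage continuous_snd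
  · intro k
    rw [Topology.IsInducing.subtypeVal.continuousOn_iff, continuousOn_iff_continuous_domRestrict]
    have hoff := continuous_offset k.1 k.2.1 k.2.2
    refine ((continuous_run k.1 k.2.1 k.2.2).comp
      (f := fun q : {q : ℝ≥0 × Config | q.2 ∈ chartSet k} =>
        (⟨((‖(q.1.2 : Pairs)‖, offset k.1 k.2.1 k.2.2 q.1.2), (min q.1.1 1 : ℝ≥0)),
          (adm_of_mem_chartSet q.2).mem_region, (min q.1.1 1).2⟩ : runDomain))
      (Continuous.subtype_mk (by fun_prop) _)).congr fun q => ?_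
    exact (step_eq_run (adm_of_mem_chartSet q.2) q.2.2.1 q.1.1).symm

/-! ### Composition of unit steps -/

/-- The time-`t` map for `t ≤ n`. -/
def iter : ℕ → ℝ≥0 → Config → Config
  | 0, _, p => p
  | n + 1, t, p => iter n (t - 1) (step t p)

theorem iter_zero_right (n : ℕ) (p : Config) : iter n 0 p = p := by
  induction n with
  | zero => rfl
  | succ n ih => rw [iter, step_zero, zero_tsub, ih]

/-- Truncated subtraction leaves time 0 for the superfluous steps, which are then identities. -/
theorem iter_succ_eq {n : ℕ} {t : ℝ≥0} (ht : t ≤ n) (p : Config) :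
    iter (n + 1) t p = iter n t p := by
  induction n generalizing t p with
  | zero =>
    obtain rfl : t = 0 := by simpa using ht
    rw [iter_zero_right, iter_zero_right]
  | succ n ih =>
    rw [iter, iter]
    exact ih (tsub_le_iff_right.2 (by exact_mod_cast ht)) _

theorem iter_eq_of_le {n m : ℕ} {t : ℝ≥0} (ht : t ≤ n) (hnm : n ≤ m) (p : Config) :
    iter m t p = iter n t p := by
  induction m, hnm using Nat.le_induction with
  | base => rfl
  | succ m hm ih => rw [iter_succ_eq (ht.trans (by exact_mod_cast hm)), ih]

theorem continuous_iter (n : ℕ) : Continuous (fun q : ℝ≥0 × Config => iter n q.1 q.2) := by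
  induction n with
  | zero => exact continuous_snd
  | succ n ih =>
    exact ih.comp (f := fun q : ℝ≥0 × Config => (q.1 - 1, step q.1 q.2))
      ((by fun_prop : Continuous fun q : ℝ≥0 × Config => q.1 - 1).prodMk continuous_step)

theorem hasDerivWithinAt_shift {f : ℝ → Pairs} {f' : Pairs} {a t : ℝ}
    (h : HasDerivWithinAt f f' (Ici (t + a)) (t + a)) :
    HasDerivWithinAt (fun s => f (s + a)) f' (Ici t) t := by
  have := h.scomp t ((hasDerivWithinAt_id t (Ici t)).add_const a)
    (fun s hs => add_le_add_left (mem_Ici.1 hs) a)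
  simpa [Function.comp_def] using this

theorem hasDerivWithinAt_iter (n : ℕ) (p : Config) {t : ℝ} (ht : t ∈ Ico (0 : ℝ) n) :
    HasDerivWithinAt (fun s : ℝ => (iter n s.toNNReal p : Pairs))
      (circulatingField (iter n t.toNNReal p)) (Ici t) t := by
  induction n generalizing p t with
  | zero => simp at ht
  | succ n ih =>
    rcases lt_or_ge t 1 with h1 | h1
    · obtain ⟨r, i, j, M, v, h, -, hp⟩ := exists_conf p.2
      have key : ∀ s : ℝ, 0 ≤ s → s ≤ 1 →
          (iter (n + 1) s.toNNReal p : Pairs) = run r i j M v s := fun s hs0 hs1 => by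
        have hs : s.toNNReal ≤ 1 := by simpa using hs1
        rw [iter, tsub_eq_zero_of_le hs, iter_zero_right, step_eq_run h hp, min_eq_left hs,
          Real.coe_toNNReal s hs0]
      refine (hasDerivWithinAt_run r h ht.1 (h1.trans one_lt_log_three)
        (key t ht.1 h1.le)).congr_of_eventuallyEq ?_ (key t ht.1 h1.le)
      filter_upwards [self_mem_nhdsWithin, mem_nhdsWithin_of_mem_nhds (Iio_mem_nhds h1)]
        with s hs hs'
      exact key s (ht.1.trans hs) (le_of_lt hs')
    · have key : ∀ s : ℝ, 1 ≤ s →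
          iter (n + 1) s.toNNReal p = iter n (s + -1).toNNReal (step 1 p) := fun s hs => by
        rw [iter, step_of_one_le (by simpa using hs), ← sub_eq_add_neg,
          NNReal.sub_def, Real.coe_toNNReal s (by linarith), NNReal.coe_one]
      have ht' := ht.2
      push_cast at ht'
      rw [key t h1]
      exact (hasDerivWithinAt_shift (f := fun s => (iter n s.toNNReal (step 1 p) : Pairs))
        (ih (step 1 p) (t := t + -1) ⟨by linarith, by linarith⟩)).congr
        (fun s hs => congrArg Subtype.val (key s (h1.trans hs))) (congrArg Subtype.val (key t h1))

/-- The time-`t` map of the semiflow. -/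
def semiflowMap (t : ℝ≥0) (p : Config) : Config := iter ⌈t⌉₊ t p

theorem semiflowMap_eq_iter {n : ℕ} {t : ℝ≥0} (ht : t ≤ n) (p : Config) :
    semiflowMap t p = iter n t p :=
  (iter_eq_of_le (Nat.le_ceil t) (Nat.ceil_le.2 ht) p).symm

theorem continuous_semiflowMap : Continuous (Function.uncurry semiflowMap) := by
  rw [continuous_iff_continuousAt]
  rintro ⟨t, p⟩
  obtain ⟨n, hn⟩ := exists_nat_gt t
  refine (continuous_iter n).continuousAt.congr ?_
  filter_upwards [(isOpen_Iio.preimage continuous_fst).mem_nhds hn] with q hq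
  exact (semiflowMap_eq_iter (le_of_lt hq) q.2).symm

theorem isForwardSolution_semiflowMap (p : Config) (T : ℝ) :
    IsForwardSolution circulatingField T (fun t => semiflowMap t.toNNReal p) := by
  refine ⟨Continuous.continuousOn ?_, fun t ht => ?_⟩
  · exact continuous_semiflowMap.comp (f := fun t : ℝ => (t.toNNReal, p))
      (by fun_prop)
  · obtain ⟨n, hn⟩ := exists_nat_gt t
    have key : ∀ s : ℝ, s < n → semiflowMap s.toNNReal p = iter n s.toNNReal p := fun s hs =>
      semiflowMap_eq_iter (Real.toNNReal_le_iff_le_coe.2 (by simpa using hs.le)) p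
    beta_reduce
    rw [key t hn]
    refine (hasDerivWithinAt_iter n p ⟨ht.1, hn⟩).congr_of_eventuallyEq ?_
      (congrArg Subtype.val (key t hn))
    filter_upwards [mem_nhdsWithin_of_mem_nhds (Iio_mem_nhds hn)] with s hs
    exact congrArg Subtype.val (key s hs)

theorem IsForwardSolution.shift {T : ℝ} {γ : ℝ → Config}
    (hγ : IsForwardSolution circulatingField T γ) {a : ℝ} (ha : 0 ≤ a) :
    IsForwardSolution circulatingField (T - a) (fun s => γ (s + a)) := by
  have hm : ∀ t ∈ Ico 0 (T - a), t + a ∈ Ico 0 T := fun t ht =>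
    ⟨add_nonneg ht.1 ha, by linarith [ht.2]⟩
  exact ⟨hγ.1.comp (by fun_prop) hm, fun t ht => hasDerivWithinAt_shift
    (f := fun s => (γ s : Pairs)) (hγ.2 _ (hm t ht))⟩

/-- The semiflow generated by the circulating field. -/
def semiflow : Flow ℝ≥0 Config where
  toFun := semiflowMap
  cont' := continuous_semiflowMap
  map_zero' p := by
    rw [semiflowMap_eq_iter (n := 0) (by simp)]; rfl
  map_add' s t p := by
    -- Additivity is uniqueness applied to the shifted orbit; the extra 1 in the horizon keeps `s`
    -- inside the half-open time interval.
    have h1 := (isForwardSolution_semiflowMap p (s + t + 1)).shift t.2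
    have h2 := isForwardSolution_semiflowMap (semiflowMap t p) (s + t + 1 - t)
    have h := h1.eqOn h2 (by
      simp only [NNReal.val_eq_coe, zero_add, Real.toNNReal_coe, Real.toNNReal_zero]
      rw [semiflowMap_eq_iter (n := 0) (t := 0) (by simp)]; rfl)
      (show (s : ℝ) ∈ Ico 0 (s + t + 1 - t : ℝ) from ⟨s.2, by linarith⟩)
    simp only [NNReal.val_eq_coe, Real.toNNReal_coe, ← NNReal.coe_add] at h
    exact h

theorem generates_semiflow : Generates circulatingField semiflow := by
  refine ⟨isForwardSolution_semiflowMap, fun T γ hγ t ht => ?_⟩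
  refine hγ.eqOn (isForwardSolution_semiflowMap (γ 0) T) ?_ ht
  simp only [Real.toNNReal_zero]
  exact (semiflow.map_zero' (γ 0)).symm

theorem semiflow_eq_run {r : Bool} {i j : Fin 3} {M v : ℝ} (h : Adm i j M v) {p : Config}
    (hp : (p : Pairs) = conf r i j M v) {t : ℝ≥0} (ht : t ≤ 1) :
    (semiflow t p : Pairs) = run r i j M v t := by
  have h1 : semiflow t p = iter 1 t p := semiflowMap_eq_iter (by exact_mod_cast ht) p
  rw [h1, iter, iter, step_eq_run h hp, min_eq_left ht]

/-! ### Asymptotic behaviour -/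

theorem semiflow_of_one_le {t : ℝ≥0} (ht : 1 ≤ t) (p : Config) :
    semiflow t p = semiflow (t - 1) (semiflow 1 p) := by
  rw [← semiflow.map_add, tsub_add_cancel_of_le ht]

/-- The norm is the distance of the current leader, so an exchange does not interrupt its logistic
growth. -/
theorem norm_semiflow (t : ℝ≥0) (p : Config) :
    ‖(semiflow t p : Pairs)‖ = growth ‖(p : Pairs)‖ t := by
  obtain ⟨n, hn⟩ := exists_nat_ge t
  induction n generalizing t p with
  | zero =>
    obtain rfl : t = 0 := by simpa using hn
    rw [semiflow.map_zero, id, NNReal.coe_zero, growth_zero]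
  | succ n ih =>
    have small : ∀ s : ℝ≥0, s ≤ 1 → ‖(semiflow s p : Pairs)‖ = growth ‖(p : Pairs)‖ s := by
      intro s hs
      obtain ⟨r, i, j, M, v, h, -, hp⟩ := exists_conf p.2
      have hs' : (s : ℝ) ≤ 1 := by exact_mod_cast hs
      rw [semiflow_eq_run h hp hs, norm_run r h s.coe_nonneg (hs'.trans_lt one_lt_log_three), hp,
        norm_conf r h]
    rcases le_total t 1 with h1 | h1
    · exact small t h1
    · rw [semiflow_of_one_le h1, ih _ _ (tsub_le_iff_right.2 (by exact_mod_cast hn)),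
        small 1 le_rfl, growth_add (norm_pos_of_mem_Config p.2) (NNReal.coe_nonneg _)
        (NNReal.coe_nonneg _), ← NNReal.coe_add, add_tsub_cancel_of_le h1]

/-! ### Entry into the disc -/

/-- Replaces the discontinuous `index` by a closed algebraic condition, needed for compactness of
the cores. -/
theorem mem_disc_iff {p : Config} : p ∈ disc ↔ ∀ k, p.1.1 k * p.1.2 k = 0 := by
  obtain ⟨⟨x, y⟩, ⟨i, a, ⟨ha0, -⟩, hx⟩, ⟨j, b, ⟨hb0, -⟩, hy⟩, hne⟩ := p
  simp only at hx hy hne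
  subst hx hy
  change index (a • e i) ≠ index (b • e j) ↔ ∀ k, (a • e i) k * (b • e j) k = 0
  rcases ha0.eq_or_lt with rfl | ha <;> rcases hb0.eq_or_lt with rfl | hb
  · exact absurd (by simp) hne
  · rw [index_smul_e hb, zero_smul, index_zero]; simp
  · rw [index_smul_e ha, zero_smul, index_zero]; simp
  · rw [index_smul_e ha, index_smul_e hb]
    simp only [smul_e_apply]
    constructor
    · intro h k
      by_cases hk : k = i
      · rw [if_neg (fun hj : k = j => h (by rw [← hk, ← hj])), mul_zero]
      · rw [if_neg hk, zero_mul]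
    · intro h hij
      have hij := Option.some.inj hij
      have := h i
      rw [if_pos rfl, if_pos hij] at this
      exact (mul_pos ha hb).ne' this

theorem mem_disc_iff_of_eq_conf {r : Bool} {i j : Fin 3} {M v : ℝ} (h : Adm i j M v) {p : Config}
    (hp : (p : Pairs) = conf r i j M v) : p ∈ disc ↔ 0 ≤ v ∨ j ≠ i := by
  have h1 : p ∈ disc ↔ ∀ k, (M • e i) k * leg i j v k = 0 := by
    rw [mem_disc_iff, hp]
    cases r
    · rfl
    · simp only [conf, pack, cond_true, mul_comm]
  rw [h1]
  rcases le_or_gt 0 v with hv | hv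
  · simp only [leg_of_nonneg i j hv, smul_e_apply, hv, true_or, iff_true]
    intro k
    by_cases hk : k = i
    · rw [if_neg (fun hk' : k = i + 1 => fin_ne_add_one i (hk.symm.trans hk')), mul_zero]
    · rw [if_neg hk, zero_mul]
  · simp only [leg_of_nonpos i j hv.le, smul_e_apply, hv.not_ge, false_or]
    constructor
    · intro hk hji
      have := hk i
      rw [if_pos rfl, if_pos hji.symm] at this
      nlinarith [h.pos]
    · intro hji k
      by_cases hk : k = i
      · rw [if_neg (fun hk' : k = j => hji (hk'.symm.trans hk)), mul_zero]
      · rw [if_neg hk, zero_mul]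

/-- Before an exchange `v` only increases, and by time 1 it has grown by at least `M`, hence is
nonnegative. After an exchange the former leader trails on an edge other than the leading one. -/
theorem semiflow_mem_disc_of_le {p : Config} {t : ℝ≥0} (ht : t ≤ 1) (hp : p ∈ disc ∨ t = 1) :
    semiflow t p ∈ disc := by
  obtain ⟨r, i, j, M, v, h, -, hpc⟩ := exists_conf p.2
  have hrun := semiflow_eq_run h hpc ht
  have ht' : (t : ℝ) ≤ 1 := by exact_mod_cast ht
  rcases le_total (t : ℝ) (hit M v) with h1 | h1
  · rw [run_of_le h1] at hrun
    rw [mem_disc_iff_of_eq_conf (adm_before_hit h t.coe_nonneg h1) hrun]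
    have h2 := travel_nonneg h.pos t.coe_nonneg
    rcases hp with hp | rfl
    · exact ((mem_disc_iff_of_eq_conf h hpc).1 hp).imp_left fun hv => add_nonneg hv h2
    · left
      have := le_travel_one h.pos h.le_one
      rw [NNReal.coe_one]
      linarith [h.neg_le]
  · rw [run_of_ge h.pos h.le_one h.le h1] at hrun
    rw [mem_disc_iff_of_eq_conf (adm_after_hit h h1
      (by linarith [hit_nonneg M v, one_lt_log_three])).1 hrun]
    exact Or.inr (fin_ne_add_one i)

theorem semiflow_mem_disc {p : Config} (hp : p ∈ disc) (t : ℝ≥0) : semiflow t p ∈ disc := by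
  obtain ⟨n, hn⟩ := exists_nat_ge t
  induction n generalizing t p with
  | zero =>
    obtain rfl : t = 0 := by simpa using hn
    rwa [semiflow.map_zero, id]
  | succ n ih =>
    rcases le_total t 1 with h1 | h1
    · exact semiflow_mem_disc_of_le h1 (Or.inl hp)
    · rw [semiflow_of_one_le h1]
      exact ih (semiflow_mem_disc_of_le le_rfl (Or.inl hp)) _
        (tsub_le_iff_right.2 (by exact_mod_cast hn))

theorem semiflow_mem_disc_of_one_le (p : Config) {t : ℝ≥0} (ht : 1 ≤ t) : semiflow t p ∈ disc := by
  rw [semiflow_of_one_le ht]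
  exact semiflow_mem_disc (semiflow_mem_disc_of_le le_rfl (Or.inr rfl)) _

theorem mem_discBoundary_iff {p : Config} : p ∈ discBoundary ↔ p ∈ disc ∧ ‖(p : Pairs)‖ = 1 := by
  have h1 := norm_le_one_of_mem_Config p.2
  have h2 : ‖p.1.1‖ ≤ ‖(p : Pairs)‖ := norm_fst_le _
  have h3 : ‖p.1.2‖ ≤ ‖(p : Pairs)‖ := norm_snd_le _
  refine and_congr_right fun _ => ⟨?_, fun h => ?_⟩
  · rintro (h | h) <;> linarith
  · rw [Prod.norm_def] at h
    rcases max_choice ‖p.1.1‖ ‖p.1.2‖ with h' | h'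
    · exact Or.inl (h'.symm.trans h)
    · exact Or.inr (h'.symm.trans h)

theorem semiflow_mem_discBoundary {p : Config} (hp : p ∈ discBoundary) (t : ℝ≥0) :
    semiflow t p ∈ discBoundary := by
  rw [mem_discBoundary_iff] at hp ⊢
  exact ⟨semiflow_mem_disc hp.1 t, by rw [norm_semiflow, hp.2, growth_one]⟩

/-! ### The cycle -/

theorem adm_rim (i : Fin 3) {v : ℝ} (hv : v ∈ Icc (-1 : ℝ) 1) : Adm i (i + 2) 1 v :=
  ⟨one_pos, le_rfl, hv.1, hv.2, by revert i; decide, fun h => absurd h (by revert i; decide)⟩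

/-- The points of the boundary of the disc. -/
def rim (r : Bool) (i : Fin 3) (v : Icc (-1 : ℝ) 1) : Config :=
  ⟨conf r i (i + 2) 1 v, conf_mem_Config r (adm_rim i v.2)⟩

theorem exists_eq_rim {p : Config} (hp : p ∈ discBoundary) : ∃ r i v, p = rim r i v := by
  rw [mem_discBoundary_iff] at hp
  obtain ⟨r, i, j, M, v, h, -, hpc⟩ := exists_conf p.2
  obtain rfl : M = 1 := by rw [← hp.2, hpc, norm_conf r h]
  refine ⟨r, i, ⟨v, h.neg_le, h.le⟩, Subtype.ext ?_⟩
  rw [hpc]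
  change _ = conf r i (i + 2) 1 v
  -- For `v ≥ 0` the edge `j` is irrelevant; otherwise `j ≠ i` and `j ≠ i + 1` leave only `i + 2`.
  rcases (mem_disc_iff_of_eq_conf h hpc).1 hp.1 with hv | hj
  · rw [conf, conf, leg_of_nonneg i j hv, leg_of_nonneg i _ hv]
  · have hj2 : ∀ a b : Fin 3, b ≠ a → b ≠ a + 1 → b = a + 2 := by decide
    rw [hj2 i j hj h.ne]

theorem semiflow_rim_of_le (r : Bool) (i : Fin 3) {v w : Icc (-1 : ℝ) 1} {t : ℝ≥0} (ht : t ≤ 1)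
    (hvw : (v : ℝ) + t = w) : semiflow t (rim r i v) = rim r i w := by
  apply Subtype.ext
  have h := adm_rim i v.2
  have ht' : (t : ℝ) ≤ hit 1 v := by
    refine not_lt.1 ((gap_pos_iff one_pos le_rfl h.le t.coe_nonneg).not.1 ?_)
    simp only [gap, travel_one, growth_one, hvw]
    linarith [w.2.2]
  rw [semiflow_eq_run h rfl ht, run_of_le ht', growth_one, travel_one, hvw]
  rfl

theorem semiflow_rim (r : Bool) (i : Fin 3) {v w : Icc (-1 : ℝ) 1} {t : ℝ≥0}
    (hvw : (v : ℝ) + t = w) : semiflow t (rim r i v) = rim r i w := by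
  have hv := v.2.1
  have hv' := v.2.2
  have hw := w.2.2
  -- An arc lasts time 2, but the chart formula is available for times up to 1, so the time is
  -- halved.
  have ht : (t / 2 : ℝ≥0) ≤ 1 := by
    rw [← NNReal.coe_le_coe]; push_cast; linarith
  have hm : ((v : ℝ) + w) / 2 ∈ Icc (-1 : ℝ) 1 := ⟨by linarith [w.2.1], by linarith⟩
  rw [← add_halves t, semiflow.map_add,
    semiflow_rim_of_le r i (w := ⟨_, hm⟩) ht (by push_cast; linarith),
    semiflow_rim_of_le r i (w := w) ht (by push_cast; linarith)]

/-- The points of the cycle at which the leading point is exchanged. -/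
def node (a : Bool × Fin 3) : Config := rim a.1 a.2 ⟨-1, by simp⟩

/-- The order in which the cycle runs through the nodes. -/
def nextNode (a : Bool × Fin 3) : Bool × Fin 3 := (!a.1, a.2 + 1)

theorem rim_one (r : Bool) (i : Fin 3) : rim r i ⟨1, by simp⟩ = node (nextNode (r, i)) := by
  apply Subtype.ext
  change conf r i (i + 2) 1 1 = conf (!r) (i + 1) (i + 1 + 2) 1 (-1)
  have : i + 1 + 2 = i := by revert i; decide
  rw [conf_tie r i _ zero_le_one, this]

theorem semiflow_node (a : Bool × Fin 3) : semiflow 2 (node a) = node (nextNode a) := by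
  rw [node, semiflow_rim a.1 a.2 (w := ⟨1, by simp⟩) (by push_cast; norm_num), rim_one]

theorem semiflow_node_iterate (k : ℕ) (a : Bool × Fin 3) :
    semiflow (k * 2) (node a) = node (nextNode^[k] a) := by
  induction k with
  | zero => simp [semiflow.map_zero]
  | succ k ih =>
    rw [Function.iterate_succ_apply', ← semiflow_node, ← ih, ← semiflow.map_add]
    congr 1
    push_cast
    ring

/-- `nextNode` adds a generator of the cyclic group ℤ/2 × ℤ/3 of order six. The exponent `k + 1`
later guarantees a positive travel time. -/
theorem exists_nextNode_iterate (a b : Bool × Fin 3) : ∃ k : Fin 6, nextNode^[k + 1] a = b := by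
  revert a b
  unfold nextNode
  decide

/-- The semiflow connects any two points of the boundary of the disc. -/
theorem exists_semiflow_eq {p q : Config} (hp : p ∈ discBoundary) (hq : q ∈ discBoundary) :
    ∃ t > 0, semiflow t p = q := by
  obtain ⟨r, i, v, rfl⟩ := exists_eq_rim hp
  obtain ⟨r', i', w, rfl⟩ := exists_eq_rim hq
  obtain ⟨k, hk⟩ := exists_nextNode_iterate (nextNode (r, i)) (r', i')
  have h1 : semiflow (1 - (v : ℝ)).toNNReal (rim r i v) = node (nextNode (r, i)) := by
    rw [← rim_one]
    exact semiflow_rim r i (by rw [Real.coe_toNNReal _ (by linarith [v.2.2])]; ring)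
  have h2 : semiflow ((w : ℝ) + 1).toNNReal (node (r', i')) = rim r' i' w :=
    semiflow_rim r' i' (by rw [Real.coe_toNNReal _ (by linarith [w.2.1])]; ring)
  have h3 := semiflow_node_iterate (k + 1) (nextNode (r, i))
  refine ⟨((w : ℝ) + 1).toNNReal + (((k : ℕ) + 1 : ℕ) * 2 + (1 - (v : ℝ)).toNNReal), by positivity,
    ?_⟩
  rw [semiflow.map_add, semiflow.map_add, h1, h3, hk, h2]

theorem range_semiflow {p : Config} (hp : p ∈ discBoundary) :
    range (fun t => semiflow t p) = discBoundary := by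
  refine Subset.antisymm ?_ fun q hq => ?_
  · rintro _ ⟨t, rfl⟩
    exact semiflow_mem_discBoundary hp t
  · obtain ⟨t, -, ht⟩ := exists_semiflow_eq hp hq
    exact ⟨t, ht⟩

theorem rim_mem_discBoundary (r : Bool) (i : Fin 3) (v : Icc (-1 : ℝ) 1) :
    rim r i v ∈ discBoundary := by
  rw [mem_discBoundary_iff, mem_disc_iff_of_eq_conf (adm_rim i v.2) rfl]
  exact ⟨Or.inr (by revert i; decide), norm_conf r (adm_rim i v.2)⟩

theorem isPeriodicOrbit_discBoundary : IsPeriodicOrbit semiflow discBoundary := by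
  have h1 := rim_mem_discBoundary false 0 ⟨-1, by simp⟩
  have h2 := rim_mem_discBoundary false 0 ⟨1, by simp⟩
  obtain ⟨T, hT, hp⟩ := exists_semiflow_eq h1 h1
  obtain ⟨t, -, ht⟩ := exists_semiflow_eq h1 h2
  refine ⟨_, ⟨T, hT, hp⟩, ⟨t, ?_⟩, (range_semiflow h1).symm⟩
  rw [ht]
  intro heq
  have := congrArg (fun p : Config => offset false 0 2 p) heq
  simp only [rim] at this
  rw [show (0 : Fin 3) + 2 = 2 by rfl, offset_conf false (by decide),
    offset_conf false (by decide)] at this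
  norm_num at this

/-! ### Attraction -/

theorem isCompact_graph : IsCompact graph := by
  have : graph = ⋃ i : Fin 3, (fun s : ℝ => s • e i) '' Icc (0 : ℝ) 1 := by
    ext x
    simp only [graph, mem_ofPred_eq, mem_iUnion, mem_image, eq_comm]
  rw [this]
  exact isCompact_iUnion fun i => isCompact_Icc.image (by fun_prop)

/-- The configurations of the disc whose norm is at least `c`, as pairs. -/
def corePairs (c : ℝ) : Set Pairs :=
  (graph ×ˢ graph) ∩ {q | (∀ k, q.1 k * q.2 k = 0) ∧ c ≤ ‖q‖}

theorem isCompact_corePairs (c : ℝ) : IsCompact (corePairs c) := by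
  refine (isCompact_graph.prod isCompact_graph).inter_right ?_
  refine IsClosed.and ?_ (isClosed_le continuous_const continuous_norm)
  simp only [ofPred_forall]
  exact isClosed_iInter fun k => isClosed_eq (by fun_prop) continuous_const

/-- The configurations of the disc whose norm is at least `c`. -/
def core (c : ℝ) : Set Config := {p | p ∈ disc ∧ c ≤ ‖(p : Pairs)‖}

/-- Disjoint supports and a positive norm keep the pairs off the diagonal, so compactness in the
ambient space passes to `Config`. -/
theorem image_core {c : ℝ} (hc : 0 < c) : Subtype.val '' core c = corePairs c := by
  ext q
  constructor
  · rintro ⟨p, ⟨h1, h2⟩, rfl⟩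
    exact ⟨⟨p.2.1, p.2.2.1⟩, mem_disc_iff.1 h1, h2⟩
  · rintro ⟨⟨h1, h2⟩, h3, h4⟩
    have hne : q.1 ≠ q.2 := fun heq => by
      have h0 : q.2 = 0 := funext fun k => by
        have := h3 k
        rw [heq] at this
        simpa using this
      have hq : q = 0 := Prod.ext (heq.trans h0) h0
      rw [hq, norm_zero] at h4
      linarith
    exact ⟨⟨q, h1, h2, hne⟩, ⟨mem_disc_iff.2 h3, h4⟩, rfl⟩

theorem isCompact_core {c : ℝ} (hc : 0 < c) : IsCompact (core c) := by
  rw [Topology.IsInducing.subtypeVal.isCompact_iff, image_core hc]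
  exact isCompact_corePairs c

theorem core_one : core 1 = discBoundary := by
  ext p
  rw [mem_discBoundary_iff]
  exact and_congr_right fun _ =>
    ⟨fun h => le_antisymm (norm_le_one_of_mem_Config p.2) h, fun h => h.ge⟩

theorem isCompact_discBoundary : IsCompact discBoundary := by
  rw [← core_one]
  exact isCompact_core one_pos

/-- The cores form a basis of neighbourhoods of the boundary within the disc. -/
theorem exists_core_subset {U : Set Config} (hU : U ∈ 𝓝ˢ discBoundary) :
    ∃ c, 0 < c ∧ c < 1 ∧ core c ⊆ U := by
  have hK : IsCompact (core (1 / 2) \ interior U) :=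
    (isCompact_core (by norm_num)).diff isOpen_interior
  have hsub := subset_interior_iff_mem_nhdsSet.2 hU
  rcases (core (1 / 2) \ interior U).eq_empty_or_nonempty with h | h
  · exact ⟨1 / 2, by norm_num, by norm_num, (sdiff_eq_empty.1 h).trans interior_subset⟩
  · obtain ⟨q, ⟨hq1, hq2⟩, hmax⟩ := hK.exists_isMaxOn h
      (continuous_subtype_val.norm : Continuous fun p : Config => ‖(p : Pairs)‖).continuousOn
    have hlt : ‖(q : Pairs)‖ < 1 := lt_of_le_of_ne (norm_le_one_of_mem_Config q.2) fun heq =>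
      hq2 (hsub (mem_discBoundary_iff.2 ⟨hq1.1, heq⟩))
    have hge : 1 / 2 ≤ ‖(q : Pairs)‖ := hq1.2
    refine ⟨(1 + ‖(q : Pairs)‖) / 2, by linarith, by linarith, fun p hp => ?_⟩
    have hp2 : (1 + ‖(q : Pairs)‖) / 2 ≤ ‖(p : Pairs)‖ := hp.2
    by_contra hpU
    have hpq : ‖(p : Pairs)‖ ≤ ‖(q : Pairs)‖ :=
      hmax (show p ∈ core (1 / 2) \ interior U from
        ⟨⟨hp.1, by linarith⟩, fun h => hpU (interior_subset h)⟩)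
    linarith

theorem eventually_growth {m c : ℝ} (hm : 0 < m) (hc : c < 1) :
    ∀ᶠ t : ℝ≥0 in atTop, c ≤ growth m t :=
  ((tendsto_growth hm).comp (NNReal.tendsto_coe_atTop.2 tendsto_id)).eventually_const_le hc

theorem eventually_mem_core (p : Config) {c : ℝ} (hc : c < 1) :
    ∀ᶠ t : ℝ≥0 in atTop, semiflow t p ∈ core c := by
  filter_upwards [eventually_ge_atTop 1, eventually_growth (norm_pos_of_mem_Config p.2) hc]
    with t ht h
  exact ⟨semiflow_mem_disc_of_one_le p ht, by rw [norm_semiflow]; exact h⟩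

theorem image2_subset_core (p : Config) {c : ℝ} (hc : 0 < c) (hc1 : c < 1) :
    ∃ u ∈ (atTop : Filter ℝ≥0), closure (image2 semiflow u {p}) ⊆ core c := by
  refine ⟨_, eventually_mem_core p hc1, closure_minimal ?_ (isCompact_core hc).isClosed⟩
  rintro _ ⟨t, ht, _, rfl, rfl⟩
  exact ht

theorem approaches_discBoundary (p : Config) : Approaches semiflow p discBoundary := by
  refine ⟨fun U hU => ?_, ?_⟩
  · obtain ⟨c, -, hc, hcU⟩ := exists_core_subset hU
    exact (eventually_mem_core p hc).mono fun t ht => hcU ht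
  · have hsub : omegaLimit atTop semiflow {p} ⊆ discBoundary := fun q hq => by
      have hmem : ∀ c, 0 < c → c < 1 → q ∈ core c := fun c hc hc1 => by
        obtain ⟨u, hu, hsub⟩ := image2_subset_core p hc hc1
        exact hsub (omegaLimit_subset_closure_image2 _ _ _ hu hq)
      rw [← core_one]
      refine ⟨(hmem (1 / 2) (by norm_num) (by norm_num)).1, le_of_forall_lt fun c hc => ?_⟩
      have h1 := (hmem (max (1 / 2) ((c + 1) / 2)) (by positivity)
        (max_lt (by norm_num) (by linarith))).2
      have h2 := le_max_right (1 / 2) ((c + 1) / 2)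
      linarith
    refine Subset.antisymm hsub fun q hq => ?_
    -- One point suffices: the ω-limit set is forward invariant, and Γ is the orbit of each of its
    -- points.
    obtain ⟨q', hq'⟩ := nonempty_omegaLimit_of_isCompact_absorbing (atTop : Filter ℝ≥0) semiflow
      {p} (isCompact_core (c := 1 / 2) (by norm_num))
      (image2_subset_core p (by norm_num) (by norm_num)) (singleton_nonempty p)
    obtain ⟨t, -, ht⟩ := exists_semiflow_eq (hsub hq') hq
    rw [← ht]
    exact semiflow.isInvariant_omegaLimit atTop {p}
      (fun t => tendsto_atTop_mono (fun s => le_add_self) tendsto_id) t hq'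

/-- A periodic point returns at all multiples of its period, so it lies in its own ω-limit set,
which is Γ. -/
theorem eq_discBoundary_of_isPeriodicOrbit {Γ : Set Config} (h : IsPeriodicOrbit semiflow Γ) :
    Γ = discBoundary := by
  obtain ⟨p, ⟨T, hT, hp⟩, -, rfl⟩ := h
  refine range_semiflow ?_
  rw [← (approaches_discBoundary p).2]
  have hn : ∀ n : ℕ, semiflow (n * T) p = p := fun n => by
    induction n with
    | zero => simp [semiflow.map_zero]
    | succ n ih =>
      rw [Nat.cast_succ, add_one_mul, semiflow.map_add, hp, ih]
  refine mem_iInter₂.2 fun u hu => subset_closure ?_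
  obtain ⟨a, ha⟩ := mem_atTop_sets.1 hu
  obtain ⟨n, hna⟩ := exists_nat_ge (a / T)
  exact ⟨n * T, ha _ ((div_le_iff₀ hT).1 hna), p, rfl, hn n⟩

/-- Starting points near Γ may lie off the disc. Up to time 1 the tube lemma controls them;
afterwards they are in the disc, and their norm has not decreased, so they stay in a core. -/
theorem stable_discBoundary {V : Set Config} (hV : V ∈ 𝓝ˢ discBoundary) :
    ∃ W ∈ 𝓝ˢ discBoundary, ∀ p ∈ W, ∀ t, semiflow t p ∈ V := by
  obtain ⟨c, hc0, hc, hcV⟩ := exists_core_subset hV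
  have hopen : IsOpen {q : ℝ≥0 × Config | semiflow q.1 q.2 ∈ interior V} :=
    isOpen_interior.preimage semiflow.cont'
  obtain ⟨u, w, -, hw, hu, hΓw, huw⟩ := generalized_tube_lemma
    (isCompact_Icc (a := (0 : ℝ≥0)) (b := 1))
    isCompact_discBoundary hopen (by
      rintro ⟨t, p⟩ ⟨-, hp⟩
      exact subset_interior_iff_mem_nhdsSet.2 hV (semiflow_mem_discBoundary hp t))
  have hcopen : IsOpen {p : Config | c < ‖(p : Pairs)‖} :=
    isOpen_lt continuous_const continuous_subtype_val.norm
  refine ⟨w ∩ {p | c < ‖(p : Pairs)‖}, (hw.inter hcopen).mem_nhdsSet.2 fun p hp =>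
    ⟨hΓw hp, ?_⟩, fun p hp t => ?_⟩
  · rw [mem_discBoundary_iff] at hp
    change c < ‖(p : Pairs)‖
    rw [hp.2]
    exact hc
  · rcases le_total t 1 with ht | ht
    · exact interior_subset (huw (show (t, p) ∈ u ×ˢ w from ⟨hu ⟨zero_le, ht⟩, hp.1⟩))
    · refine hcV ⟨semiflow_mem_disc_of_one_le p ht, ?_⟩
      rw [norm_semiflow]
      exact (le_of_lt hp.2).trans (le_growth (norm_pos_of_mem_Config p.2)
        (norm_le_one_of_mem_Config p.2) t.coe_nonneg)

theorem exists_notMem_discBoundary : ∃ q : Config, q ∉ discBoundary := by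
  have h : Adm 0 2 (1 / 2) 0 :=
    ⟨by norm_num, by norm_num, by norm_num, by norm_num, by decide, fun h => absurd h (by decide)⟩
  refine ⟨⟨_, conf_mem_Config false h⟩, fun hq => ?_⟩
  have := (mem_discBoundary_iff.1 hq).2
  rw [norm_conf false h] at this
  norm_num at this

theorem isAttractingLimitCycle_discBoundary : IsAttractingLimitCycle semiflow discBoundary := by
  obtain ⟨q, hq⟩ := exists_notMem_discBoundary
  exact ⟨isPeriodicOrbit_discBoundary, ⟨q, hq, approaches_discBoundary q⟩,
    fun V hV => stable_discBoundary hV, ⟨univ, univ_mem, fun p _ => approaches_discBoundary p⟩⟩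

theorem isRepelling_diagonal : IsRepelling semiflow diagonal := by
  refine ⟨(corePairs (1 / 2))ᶜ, (isCompact_corePairs _).isClosed.isOpen_compl.mem_nhdsSet.2 ?_, ?_⟩
  · rintro q ⟨-, hq⟩ hcore
    rw [← image_core (by norm_num)] at hcore
    obtain ⟨p, -, rfl⟩ := hcore
    exact p.2.2.2 hq.symm
  · intro V hV
    have h0 : (0 : Pairs) ∈ diagonal := ⟨⟨0, 0, by simp, by simp⟩, rfl⟩
    -- Only the part of `V` near the origin matters: unit time brings every configuration into the
    -- disc, and a lower bound `c` on the norm fixes the time to reach norm 1/2.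
    obtain ⟨c, hc, hcV⟩ := Metric.mem_nhds_iff.1 (nhds_le_nhdsSet h0 hV)
    obtain ⟨T, hT⟩ := eventually_atTop.1 (eventually_growth hc (c := 1 / 2) (by norm_num))
    refine ⟨max 1 T, fun p hp t ht hmem => hmem ?_⟩
    have hcp : c ≤ ‖(p : Pairs)‖ := not_lt.1 fun h => hp (hcV (by simpa using h))
    rw [← image_core (by norm_num)]
    refine mem_image_of_mem _ ⟨semiflow_mem_disc_of_one_le p ((le_max_left _ _).trans ht), ?_⟩
    rw [norm_semiflow]
    exact (hT t ((le_max_right _ _).trans ht)).trans (growth_mono_left hc hcp t.coe_nonneg)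

theorem exists_index_eq {p : Config} (hp : p ∈ discBoundary) {i j : Fin 3} (hij : i ≠ j) :
    ∃ t : ℝ≥0, index (semiflow t p).1.1 = some i ∧ index (semiflow t p).1.2 = some j := by
  have hmem : ((1 : ℝ) • e i, (1 / 2 : ℝ) • e j) ∈ Config :=
    ⟨smul_e_mem_graph i zero_le_one le_rfl, smul_e_mem_graph j (by norm_num) (by norm_num),
      fun h => hij (smul_e_inj one_ne_zero h).1⟩
  have h1 : index ((1 : ℝ) • e i) = some i := index_smul_e one_pos i
  have h2 : index ((1 / 2 : ℝ) • e j) = some j := index_smul_e (by norm_num) j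
  have hq : (⟨_, hmem⟩ : Config) ∈ discBoundary := by
    refine ⟨?_, Or.inl ?_⟩
    · change index _ ≠ index _
      rw [h1, h2]
      exact fun h => hij (Option.some.inj h)
    · change ‖(1 : ℝ) • e i‖ = 1
      rw [norm_smul_e, abs_one]
  obtain ⟨t, -, ht⟩ := exists_semiflow_eq hp hq
  exact ⟨t, by rw [ht]; exact h1, by rw [ht]; exact h2⟩

/-! ### Piecewise smoothness -/

/-- The field is the initial velocity of an orbit that stays in `Config`, so its difference
quotients witness tangency. -/
theorem circulatingField_mem_posTangentConeAt (p : Config) :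
    circulatingField p ∈ posTangentConeAt Config (p : Pairs) := by
  have h := (generates_semiflow.1 p 1).2 0 (by simp)
  simp only [Real.toNNReal_zero, semiflow.map_zero, id] at h
  have h1 := hasDerivWithinAt_iff_tendsto_slope.1 h
  rw [Ici_sdiff_left] at h1
  refine mem_tangentConeAt_of_seq (𝓝[>] (0 : ℝ)) (fun t => t⁻¹.toNNReal)
    (fun t => (semiflow t.toNNReal p : Pairs) - p) ?_ ?_ ?_
  · have hc := h.continuousWithinAt.tendsto.mono_left (nhdsWithin_mono _ Ioi_subset_Ici_self)
    simp only [Real.toNNReal_zero, semiflow.map_zero, id] at hc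
    simpa using hc.sub_const (p : Pairs)
  · exact Eventually.of_forall fun t => by
      rw [add_sub_cancel]
      exact (semiflow t.toNNReal p).2
  · refine h1.congr' ?_
    filter_upwards [self_mem_nhdsWithin] with t ht
    have ht' : 0 ≤ t⁻¹ := inv_nonneg.2 (le_of_lt ht)
    rw [slope_def_module, sub_zero, NNReal.smul_def, Real.coe_toNNReal _ ht', Real.toNNReal_zero,
      semiflow.map_zero, id]

/-! ### The cells -/

/-- The vertices of the triangle of all parameters `0 ≤ u ≤ M ≤ 1`. -/
def triangle : Set (ℝ × ℝ) := {(0, 0), (1, 0), (1, 1)}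

theorem finite_triangle : triangle.Finite := by
  unfold triangle
  exact Set.toFinite _

/-- The parameters `(M, u)` of the cell in which the leading point is at distance `M` on the edge
`i` and the trailing point at distance `u` on the edge `k`. -/
def cellParam (i k : Fin 3) : Set (ℝ × ℝ) :=
  {q | 0 < q.1 ∧ q.1 ≤ 1 ∧ 0 ≤ q.2 ∧ q.2 ≤ q.1 ∧ (k = i + 1 → q.2 < q.1) ∧
    (k = i → q.2 < q.1) ∧ (k ≠ i + 1 → 0 < q.2)}

theorem convex_cellParam (i k : Fin 3) : Convex ℝ (cellParam i k) := by
  have pos_comb : ∀ {x y a b : ℝ}, 0 < x → 0 < y → 0 ≤ a → 0 ≤ b → a + b = 1 →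
      0 < a * x + b * y := fun hx hy ha hb hab => convex_Ioi (0 : ℝ) hx hy ha hb hab
  rintro ⟨M, u⟩ ⟨h1, h2, h3, h4, h5, h6, h7⟩ ⟨M', u'⟩ ⟨h1', h2', h3', h4', h5', h6', h7'⟩
    a b ha hb hab
  simp only at *
  have hlt : u < M → u' < M' → a * u + b * u' < a * M + b * M' := fun h h' => by
    have := pos_comb (sub_pos.2 h) (sub_pos.2 h') ha hb hab
    linarith
  refine ⟨pos_comb h1 h1' ha hb hab, ?_, ?_, ?_, fun hk => hlt (h5 hk) (h5' hk),
    fun hk => hlt (h6 hk) (h6' hk), fun hk => pos_comb (h7 hk) (h7' hk) ha hb hab⟩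
  · change a * M + b * M' ≤ 1
    nlinarith
  · change 0 ≤ a * u + b * u'
    positivity
  · change a * u + b * u' ≤ a * M + b * M'
    gcongr

theorem cellParam_subset (i k : Fin 3) : cellParam i k ⊆ convexHull ℝ triangle := by
  rintro ⟨M, u⟩ ⟨h1, h2, h3, h4, -⟩
  simp only at h1 h2 h3 h4
  -- The barycentric coordinates of `(M, u)` in the triangle.
  refine mem_convexHull_of_exists_fintype ![1 - M, M - u, u] ![(0, 0), (1, 0), (1, 1)] ?_ ?_ ?_ ?_
  · intro k
    fin_cases k
    · exact sub_nonneg.2 h2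
    · exact sub_nonneg.2 h4
    · exact h3
  · simp [Fin.sum_univ_three]
  · intro k
    fin_cases k <;> simp [triangle]
  · simp [Fin.sum_univ_three]

theorem triangle_subset (i k : Fin 3) : triangle ⊆ closure (cellParam i k) := by
  intro w hw
  -- The point (1, 1/2) meets all strict conditions of the cell, so the open segment from any vertex
  -- to it lies in the cell and accumulates at the vertex.
  have hseg : openSegment ℝ w (1, 1 / 2) ⊆ cellParam i k := by
    rintro _ ⟨a, b, ha, hb, hab, rfl⟩
    rcases hw with rfl | rfl | rfl <;>
    · simp only [cellParam, Prod.smul_mk, Prod.mk_add_mk, smul_eq_mul, mem_ofPred_eq]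
      refine ⟨?_, ?_, ?_, ?_, fun _ => ?_, fun _ => ?_, fun _ => ?_⟩ <;> linarith
  exact closure_mono hseg (segment_subset_closure_openSegment (left_mem_segment ℝ _ _))

theorem closure_cellParam (i k : Fin 3) : closure (cellParam i k) = convexHull ℝ triangle := by
  refine Subset.antisymm (closure_minimal (cellParam_subset i k) ?_)
    (convexHull_min (triangle_subset i k) (convex_cellParam i k).closure)
  exact finite_triangle.isClosed_convexHull ℝ

/-- The parametrization of a cell. -/
def cellMap (r : Bool) (i k : Fin 3) : ℝ × ℝ →ₗ[ℝ] Pairs where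
  toFun q := pack r (q.1 • e i) (q.2 • e k)
  map_add' q q' := by cases r <;> simp [pack, add_smul]
  map_smul' c q := by cases r <;> simp [pack, mul_smul]

/-- The cells of the circulating field. -/
def cell (c : Bool × Fin 3 × Fin 3) : Set Pairs := cellMap c.1 c.2.1 c.2.2 '' cellParam c.2.1 c.2.2

theorem closure_cell (c : Bool × Fin 3 × Fin 3) :
    closure (cell c) = convexHull ℝ (cellMap c.1 c.2.1 c.2.2 '' triangle) := by
  rw [← LinearMap.image_convexHull, ← closure_cellParam c.2.1 c.2.2, cell]
  refine (image_closure_of_isCompact ?_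
    (LinearMap.continuous_of_finiteDimensional _).continuousOn).symm
  rw [closure_cellParam]
  exact finite_triangle.isCompact_convexHull ℝ

/-- The cells cut the charts at `v = 0`, where the trailing velocity jumps: `k = i + 1` is the part
`v ≥ 0`, any other `k` the part `v < 0` with `j = k`. -/
theorem exists_conf_of_mem_cell {c : Bool × Fin 3 × Fin 3} {p : Pairs} (hp : p ∈ cell c) :
    ∃ j M v, Adm c.2.1 j M v ∧ v < M ∧ p = conf c.1 c.2.1 j M v ∧
      if c.2.2 = c.2.1 + 1 then 0 ≤ v else v < 0 ∧ j = c.2.2 := by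
  obtain ⟨r, i, k⟩ := c
  obtain ⟨⟨M, u⟩, ⟨h1, h2, h3, h4, h5, h6, h7⟩, rfl⟩ := hp
  simp only at *
  by_cases hk : k = i + 1
  · have := h5 hk
    refine ⟨i, M, u, ⟨h1, h2, by linarith, h4, fin_ne_add_one i, fun _ => by linarith⟩, this,
      ?_, ?_⟩
    · rw [conf, leg_of_nonneg i i h3, ← hk]; rfl
    · rw [if_pos hk]; exact h3
  · have := h7 hk
    refine ⟨k, M, -u, ⟨h1, h2, by linarith, by linarith, hk, fun hki => by linarith [h6 hki]⟩,
      by linarith, ?_, ?_⟩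
    · rw [conf, leg_of_nonpos i k (by linarith), neg_neg]; rfl
    · rw [if_neg hk]; exact ⟨by linarith, rfl⟩

theorem iUnion_cell : ⋃ c, cell c = Config := by
  refine Subset.antisymm (iUnion_subset fun c p hp => ?_) fun p hp => mem_iUnion.2 ?_
  · obtain ⟨j, M, v, h, -, rfl, -⟩ := exists_conf_of_mem_cell hp
    exact conf_mem_Config _ h
  · obtain ⟨r, i, j, M, v, h, hv, rfl⟩ := exists_conf hp
    have h1 := h.pos
    have h2 := h.neg_le
    rcases le_or_gt 0 v with h0 | h0
    · refine ⟨(r, i, i + 1), (M, v), ⟨h1, h.le_one, h0, h.le, fun _ => hv, fun _ => hv,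
        fun hi => absurd rfl hi⟩, ?_⟩
      rw [conf, leg_of_nonneg i j h0]
      rfl
    · refine ⟨(r, i, j), (M, -v), ⟨h1, h.le_one, ?_, ?_, fun hj => absurd hj h.ne, fun hj => ?_,
        fun _ => ?_⟩, ?_⟩
      · change 0 ≤ -v; linarith
      · change -v ≤ M; linarith
      · change -v < M; linarith [h.lt hj]
      · change 0 < -v; linarith
      · rw [conf, leg_of_nonpos i j h0.le]
        rfl

/-- A smooth extension of the restriction of the circulating field to a cell. -/
def cellField (c : Bool × Fin 3 × Fin 3) (p : Pairs) : Pairs :=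
  pack c.1 ((lead c.1 p c.2.1 * (1 - lead c.1 p c.2.1)) • e c.2.1)
    ((if c.2.2 = c.2.1 + 1 then lead c.1 p c.2.1 else -lead c.1 p c.2.1) • e c.2.2)

theorem contDiff_cellField (c : Bool × Fin 3 × Fin 3) : ContDiff ℝ ∞ (cellField c) := by
  obtain ⟨r, i, k⟩ := c
  unfold cellField
  cases r <;> by_cases hk : k = i + 1 <;>
    simp only [hk, if_true, if_false, pack, lead, cond_true, cond_false] <;> fun_prop

theorem circulatingField_eq_cellField {c : Bool × Fin 3 × Fin 3} {p : Config}
    (hp : (p : Pairs) ∈ cell c) : circulatingField p = cellField c p := by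
  obtain ⟨j, M, v, h, hv, hpc, hc⟩ := exists_conf_of_mem_cell hp
  rw [circulatingField_conf h hv hpc, cellField, hpc, lead_conf]
  by_cases hk : c.2.2 = c.2.1 + 1
  · rw [if_pos hk] at hc
    rw [if_neg hc.not_gt, if_pos hk, hk]
  · rw [if_neg hk] at hc
    rw [if_pos hc.1, if_neg hk, hc.2]

theorem isPiecewiseSmoothVectorField_circulatingField :
    IsPiecewiseSmoothVectorField circulatingField := by
  refine ⟨circulatingField_mem_posTangentConeAt, ?_⟩
  let f := (Fintype.equivFin (Bool × Fin 3 × Fin 3)).symm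
  refine ⟨_, fun k => cell (f k), fun k => cellField (f k), ?_, fun k => ⟨?_, ?_, ?_, ?_⟩⟩
  · rw [← iUnion_cell]
    exact f.surjective.iUnion_comp cell
  · exact (convex_cellParam _ _).linear_image _
  · exact ⟨_, finite_triangle.image _, closure_cell (f k)⟩
  · exact contDiff_cellField _
  · exact fun p hp => circulatingField_eq_cellField hp

end YGraph

end

theorem mainTheorem2 :
    ∃ X : YGraph.Config → YGraph.Pairs,
      X = YGraph.circulatingField ∧
      YGraph.IsPiecewiseSmoothVectorField X ∧
      (∀ p, X p ≠ 0) ∧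
      ∃ φ : Flow ℝ≥0 YGraph.Config,
        YGraph.Generates X φ ∧
        YGraph.IsRepelling φ YGraph.diagonal ∧
        ∃ Γ : Set YGraph.Config,
          Γ = YGraph.discBoundary ∧
          YGraph.IsAttractingLimitCycle φ Γ ∧
          (∀ Γ' : Set YGraph.Config, YGraph.IsPeriodicOrbit φ Γ' → Γ' = Γ) ∧
          (∀ p : YGraph.Config, YGraph.Approaches φ p Γ) ∧
          ∀ p ∈ Γ, ∀ i j : Fin 3, i ≠ j →
            ∃ t : ℝ≥0, YGraph.index (φ t p).1.1 = some i ∧ YGraph.index (φ t p).1.2 = some j := by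
  exact ⟨YGraph.circulatingField, rfl, YGraph.isPiecewiseSmoothVectorField_circulatingField,
    YGraph.circulatingField_ne_zero, YGraph.semiflow, YGraph.generates_semiflow,
    YGraph.isRepelling_diagonal, YGraph.discBoundary, rfl,
    YGraph.isAttractingLimitCycle_discBoundary,
    fun _ => YGraph.eq_discBoundary_of_isPeriodicOrbit, YGraph.approaches_discBoundary,
    fun _ hp _ _ => YGraph.exists_index_eq hp⟩
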